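/- Random sequential covering by dimers. For an integer $L\ge 0$ start with the interval of sites $\{1,\dots,L\}$, all uncovered. The dimer labelled $k\in\{1,\dots,L+1\}$ covers the two sites $k-1$ and $k$ (so it may overhang the interval by one site). Dimers are deposited one after another; at each step the next dimer is chosen uniformly at random among those that cover at least one still uncovered site of $\{1,\dots,L\}$. The process stops when all sites are covered. Let $N=N_L$ be the total number of deposited dimers (so $N_0=0$), let $F(\lambda,L)=\langle e^{\lambda N_L}\rangle$ for real $\lambda$, and let the cumulants $\langle N^n\rangle_c$ be defined by $\ln\langle e^{\lambda N}\rangle=\sum_{n\ge1}\frac{\lambda^n}{n!}\langle N^n\rangle_c$ near $\lambda=0$. For real $\lambda$ put $$\Lambda=e^{\lambda/2}\sqrt{1-e^{\lambda}},\qquad y(\lambda)=\frac{\arctan\big(e^{-\lambda/2}\sqrt{1-e^\lambda}\big)}{e^{\lambda/2}\sqrt{1-e^\lambda}}\quad(\lambda\ne0),\qquad y(0)=1,$$ with principal branches of the complex square root and arctangent, and $U(\lambda)=-\ln y(\lambda)$. Then: 1. All exponential moments of $N_L$ are finite; for every real $\lambda$ the number $y(\lambda)$ is real and positive, and $y(\lambda)\to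 y(0)=1$ as $\lambda\to0$. 2. For real $\lambda\neq0$ and complex $x$ with $|x|<y(\lambda)$ and $\cos(\Lambda x)\ne0$, the denominator below does not vanish, the series converges and $$\Phi(\lambda,x):=\sum_{L\ge0}F(\lambda,L)\,x^{L+1}=\frac{\tan(\Lambda x)}{\Lambda-e^{\lambda}\tan(\Lambda x)}.$$ For $\lambda=0$ and $|x|<1$ one has $\Phi(0,x)=\frac{x}{1-x}$, which is the limit of the right-hand side as $\lambda\to0$. 3. As a meromorphic function of $x$, the closed form of $\Phi(\lambda,\cdot)$ in part 2 has a simple pole at $x=y(\lambda)$, for every real $\lambda$. 4. For every real $\lambda$, $\displaystyle\lim_{L\to\infty}\frac{\ln\langle e^{\lambda N_L}\rangle}{L}=U(\lambda)=-\ln y(\lambda)$. 5. $U$ is real-analytic at $0$, and for every $n\ge1$, $\displaystyle\lim_{L\to\infty}\frac{\langle N_L^n\rangle_c}{L}=U^{(n)}(0)$. In particular, as $L\to\infty$, $$\frac{\langle N\rangle}{L}\to\frac23,\qquad \frac{\langle N^2\rangle_c}{L}=\frac{\operatorname{Var}N}{L}\to\frac{2}{45},\qquad \frac{\langle N^3\rangle_c}{L}\to\frac{2}{945},\qquad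 \frac{\langle N^4\rangle_c}{L}\to-\frac{22}{4725}.$$ 6. The Mandel parameter satisfies $\displaystyle Q_L=\frac{\operatorname{Var}N_L}{\langle N_L\rangle}-1\to-\frac{14}{15}$ as $L\to\infty$. -/

import Mathlib

open Filter Topology MeasureTheory ProbabilityTheory

noncomputable section

namespace DimerCovering

/-- The dimer with label `k ≥ 1` occupies the two lattice sites `k - 1` and `k`. -/
def dimer (k : ℕ) : Finset ℕ := {k - 1, k}

/-- The labels `k ∈ {1, …, L + 1}` of the dimers whose deposition is accepted when `U` is the set
of uncovered sites of the interval `{1, …, L}`: those that cover at least one site of `U`. -/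
def admissible (L : ℕ) (U : Finset ℕ) : Finset ℕ :=
  (Finset.Icc 1 (L + 1)).filter fun k => ¬ Disjoint (dimer k) U

lemma card_sdiff_dimer_lt {L : ℕ} {U : Finset ℕ} {k : ℕ} (hk : k ∈ admissible L U) :
    (U \ dimer k).card < U.card := by
  have h := (Finset.mem_filter.mp hk).2
  obtain ⟨a, ha, haU⟩ := Finset.not_disjoint_iff.mp h
  refine Finset.card_lt_card ⟨Finset.sdiff_subset, fun hs => ?_⟩
  exact (Finset.mem_sdiff.mp (hs haU)).2 ha

/-- The law of the random sequence of labels of the dimers that are deposited from the moment when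
the uncovered sites are exactly those in `U`: as long as some deposition is accepted, the next
dimer is chosen uniformly among the accepted ones; otherwise the process stops. -/
def history (L : ℕ) (U : Finset ℕ) : PMF (List ℕ) :=
  if h : (admissible L U).Nonempty then
    (PMF.uniformOfFinset (admissible L U) h).bindOnSupport fun k _hk =>
      (history L (U \ dimer k)).map (List.cons k)
  else PMF.pure []
termination_by U.card
decreasing_by
  exact card_sdiff_dimer_lt ((PMF.mem_support_uniformOfFinset_iff h k).mp _hk)

/-- The law of the number `N` of dimers in the congested configuration reached from the empty
interval `{1, …, L}`. -/
def countPMF (L : ℕ) : PMF ℕ := (history L (Finset.Icc 1 L)).map List.length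

/-- The same law as a measure on `ℕ`. -/
def countLaw (L : ℕ) : Measure ℕ := (countPMF L).toMeasure

/-- The number `N` as a real random variable on the probability space `(ℕ, countLaw L)`. -/
def count (n : ℕ) : ℝ := n

/-- `F(λ, L) = ⟨e^{λN}⟩`. -/
def F (lam : ℝ) (L : ℕ) : ℝ := mgf count (countLaw L) lam

/-- The `n`-th cumulant of a real random variable: the `n`-th Taylor coefficient (times `n!`) at
`0` of its cumulant generating function `λ ↦ ln E[e^{λX}]`. -/
def cumulant {Ω : Type*} [MeasurableSpace Ω] (n : ℕ) (X : Ω → ℝ) (μ : Measure Ω) : ℝ :=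
  iteratedDeriv n (cgf X μ) 0

/-- The Mandel parameter of `N` on the interval of length `L`: variance over mean, minus one. -/
def mandelQ (L : ℕ) : ℝ :=
  Var[count; countLaw L] / (∫ n, count n ∂(countLaw L)) - 1

/-- The principal square root `√(1 - e^λ)`, which is imaginary for `λ > 0`. -/
def root (lam : ℝ) : ℂ := (1 - Complex.exp lam) ^ (1 / 2 : ℂ)

/-- `Λ = e^{λ/2} √(1 - e^λ)`. -/
def Lam (lam : ℝ) : ℂ := Complex.exp (lam / 2) * root lam

/-- The closed form `tan(Λx) / (Λ - e^λ tan(Λx))`, used for `λ ≠ 0`. -/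
def closedForm (lam : ℝ) (x : ℂ) : ℂ :=
  Complex.tan (Lam lam * x) / (Lam lam - Complex.exp lam * Complex.tan (Lam lam * x))

/-- `y(λ) = arctan(e^{-λ/2} √(1 - e^λ)) / (e^{λ/2} √(1 - e^λ))` for `λ ≠ 0`, and `y(0) = 1`.
The quotient is a real number; the theorem asserts this as well. -/
def y (lam : ℝ) : ℝ :=
  if lam = 0 then 1 else (Complex.arctan (Complex.exp (-lam / 2) * root lam) / Lam lam).re

/-- `U(λ) = -ln y(λ)`. -/
def U (lam : ℝ) : ℝ := -Real.log (y lam)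

end DimerCovering

end

namespace DimerCovering

/-! ### Combinatorics: first-step analysis and the quadratic recursion for the exponential moments
-/

section Combinatorics

open scoped ENNReal

/-! The first dimer cuts the interval into two parts that evolve independently. With z = e^λ this
gives a convolution recursion for F(λ, ·), equivalent, for Ψ = 1 + Φ, to the Riccati equation Ψ' =
zΨ² + 1 - z with Ψ(0) = 1 (`F_rec`, `F_eq_coef`).

Its solution is Ψ(x) = z⁻¹Λ cot(Λ(y - x)) with Λ² = z(1 - z) and Λ cot(Λy) = z, that is y =
arctan(Λ/z)/Λ; the addition formulas turn Ψ - 1 into the closed form (`hasDerivAt_ricc`,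
`isParam_arctan`, `closedForm_eq`). The function w cot w, regular at 0, replaces the cotangent so
that λ = 0 needs no separate theory. The poles are the points y - nπ/Λ. Since |Re(Λy)| < π/2, the
pole y is strictly closest to 0, so the series converges for |x| < y. Subtracting the pole and
applying Cauchy's estimate on a slightly larger circle gives e^λ y^(L+2) F(λ, L) → 1
(`norm_coef_sub_le`, `tendsto_scaled_F`), hence the limit of L⁻¹ ln F.

For cumulants the same estimate is made uniform for complex λ near 0. There y extends
holomorphically, because arctan(t)/t depends only on t², so no branch of the root enters
(`exists_norm_ratio_sub_one_le`). Thus L⁻¹ ln F converges uniformly on a complex disc to -ln y, and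
Weierstrass' theorem gives convergence of all derivatives at 0 (`tendsto_cumulant`). The numerical
values follow by differentiating a first-order equation for U (`UC_ode`, `taylor_of_ode`). -/

lemma tsum_bind_mul {α β : Type*} (p : PMF α) (f : α → PMF β) (g : β → ℝ≥0∞) :
    ∑' b, p.bind f b * g b = ∑' a, p a * ∑' b, f a b * g b := by
  simp_rw [PMF.bind_apply, ← ENNReal.tsum_mul_right, ← ENNReal.tsum_mul_left, mul_assoc]
  exact ENNReal.tsum_comm

lemma tsum_pure_mul {β : Type*} (b : β) (g : β → ℝ≥0∞) :
    ∑' c, (PMF.pure b) c * g c = g b := by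
  rw [tsum_eq_single b]
  · simp
  · intro c hc
    simp [PMF.pure_apply_of_ne _ _ hc]

lemma tsum_map_mul {α β : Type*} (p : PMF α) (f : α → β) (g : β → ℝ≥0∞) :
    ∑' b, p.map f b * g b = ∑' a, p a * g (f a) := by
  rw [PMF.map, tsum_bind_mul]
  simp_rw [Function.comp_apply, tsum_pure_mul]

lemma mem_admissible {L k : ℕ} {U : Finset ℕ} :
    k ∈ admissible L U ↔ (1 ≤ k ∧ k ≤ L + 1) ∧ (k - 1 ∈ U ∨ k ∈ U) := by
  simp only [admissible, Finset.mem_filter, Finset.mem_Icc, dimer, Finset.not_disjoint_iff,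
    Finset.mem_insert, Finset.mem_singleton, exists_eq_or_imp, exists_eq_left]

/-- The generating function `E[w ^ N]` of the number of dimers deposited from the moment when the
uncovered sites are those in `U`. -/
noncomputable def gen (w : ℝ≥0∞) (L : ℕ) (U : Finset ℕ) : ℝ≥0∞ :=
  ∑' l, history L U l * w ^ l.length

lemma gen_of_empty {w : ℝ≥0∞} {L : ℕ} {U : Finset ℕ} (h : admissible L U = ∅) :
    gen w L U = 1 := by
  rw [gen, history, dif_neg (by simp [h]), tsum_pure_mul]
  simp

/-- Condition on the first dimer. Multiplying by the number of choices avoids division and keeps the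
identity valid when no dimer is accepted. -/
lemma card_mul_gen (w : ℝ≥0∞) (L : ℕ) (U : Finset ℕ) :
    ((admissible L U).card : ℝ≥0∞) * gen w L U
      = w * ∑ k ∈ admissible L U, gen w L (U \ dimer k) := by
  rcases (admissible L U).eq_empty_or_nonempty with h | h
  · simp [h]
  have hc : ((admissible L U).card : ℝ≥0∞) ≠ 0 := by
    simpa using h.ne_empty
  rw [gen, history, dif_pos h, PMF.bindOnSupport_eq_bind _
    (fun k => (history L (U \ dimer k)).map (List.cons k)), tsum_bind_mul]
  rw [tsum_eq_sum (s := admissible L U)]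
  · rw [Finset.mul_sum, Finset.mul_sum]
    refine Finset.sum_congr rfl fun k hk => ?_
    rw [PMF.uniformOfFinset_apply_of_mem h hk, ← mul_assoc,
      ENNReal.mul_inv_cancel hc (ENNReal.natCast_ne_top _), one_mul, tsum_map_mul, gen,
      ← ENNReal.tsum_mul_left]
    refine tsum_congr fun l => ?_
    rw [List.length_cons, pow_succ]
    ring
  · intro k hk
    rw [PMF.uniformOfFinset_apply_of_notMem h hk, zero_mul]

/-- Every deposition removes an uncovered site, so the recursion reaches the empty state after
boundedly many steps and only finite sums occur. -/
lemma gen_ne_top {w : ℝ≥0∞} (hw : w ≠ ∞) (L : ℕ) (U : Finset ℕ) : gen w L U ≠ ∞ := by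
  induction hn : U.card using Nat.strong_induction_on generalizing U with
  | _ n ih =>
    rcases (admissible L U).eq_empty_or_nonempty with h | h
    · simp [gen_of_empty h]
    intro htop
    have h1 := card_mul_gen w L U
    have h2 : w * ∑ k ∈ admissible L U, gen w L (U \ dimer k) ≠ ∞ := by
      refine ENNReal.mul_ne_top hw (ENNReal.sum_ne_top.2 fun k hk => ?_)
      exact ih _ (hn ▸ card_sdiff_dimer_lt hk) _ rfl
    rw [htop, ENNReal.mul_top (by simpa using h.ne_empty)] at h1
    exact h2 h1.symm

lemma admissible_union (L : ℕ) (U V : Finset ℕ) :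
    admissible L (U ∪ V) = admissible L U ∪ admissible L V := by
  ext k
  simp only [Finset.mem_union, mem_admissible]
  tauto

lemma admissible_mono (L : ℕ) {U V : Finset ℕ} (h : U ⊆ V) : admissible L U ⊆ admissible L V := by
  intro k
  simp only [mem_admissible]
  exact fun hk => ⟨hk.1, hk.2.imp (fun x => h x) (fun x => h x)⟩

lemma sdiff_dimer_of_notMem {L k : ℕ} {U V : Finset ℕ} (hU : k ∈ admissible L U)
    (hV : k ∉ admissible L V) : V \ dimer k = V := by
  rw [mem_admissible] at hU hV
  refine Finset.sdiff_eq_self_of_disjoint (Finset.disjoint_right.2 fun a ha haV => hV ⟨hU.1, ?_⟩)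
  simp only [dimer, Finset.mem_insert, Finset.mem_singleton] at ha
  rcases ha with rfl | rfl <;> tauto

/-- The process factorizes over two sets of sites that no dimer joins. -/
lemma gen_union {w : ℝ≥0∞} (L : ℕ) (U V : Finset ℕ)
    (h : Disjoint (admissible L U) (admissible L V)) :
    gen w L (U ∪ V) = gen w L U * gen w L V := by
  induction hn : U.card + V.card using Nat.strong_induction_on generalizing U V with
  | _ n ih =>
    by_cases h0 : admissible L U ∪ admissible L V = ∅
    · obtain ⟨hU, hV⟩ := Finset.union_eq_empty.1 h0
      rw [gen_of_empty ((admissible_union L U V).trans h0), gen_of_empty hU, gen_of_empty hV,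
        one_mul]
    -- After multiplication by the total number of accepted dimers, the sum over the first dimer
    -- splits according to which of the two sets it hits; the other set is left unchanged.
    have hc : (((admissible L U ∪ admissible L V).card : ℕ) : ℝ≥0∞) ≠ 0 := by
      simpa [-Finset.union_eq_empty] using h0
    refine (ENNReal.mul_right_inj hc (ENNReal.natCast_ne_top _)).1 ?_
    have h1 := card_mul_gen w L (U ∪ V)
    rw [admissible_union] at h1
    rw [h1, Finset.sum_union h]
    have hA : ∑ k ∈ admissible L U, gen w L ((U ∪ V) \ dimer k)
        = (∑ k ∈ admissible L U, gen w L (U \ dimer k)) * gen w L V := by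
      rw [Finset.sum_mul]
      refine Finset.sum_congr rfl fun k hk => ?_
      rw [Finset.union_sdiff_distrib, sdiff_dimer_of_notMem hk (Finset.disjoint_left.1 h hk)]
      refine ih _ ?_ _ _ (h.mono_left (admissible_mono L Finset.sdiff_subset)) rfl
      have := card_sdiff_dimer_lt hk
      omega
    have hB : ∑ k ∈ admissible L V, gen w L ((U ∪ V) \ dimer k)
        = gen w L U * ∑ k ∈ admissible L V, gen w L (V \ dimer k) := by
      rw [Finset.mul_sum]
      refine Finset.sum_congr rfl fun k hk => ?_
      rw [Finset.union_sdiff_distrib, sdiff_dimer_of_notMem hk (Finset.disjoint_right.1 h hk)]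
      refine ih _ ?_ _ _ (h.mono_right (admissible_mono L Finset.sdiff_subset)) rfl
      have := card_sdiff_dimer_lt hk
      omega
    have e1 := card_mul_gen w L U
    have e2 := card_mul_gen w L V
    rw [hA, hB, Finset.card_union_of_disjoint h, Nat.cast_add]
    calc _ = (w * ∑ k ∈ admissible L U, gen w L (U \ dimer k)) * gen w L V
          + gen w L U * (w * ∑ k ∈ admissible L V, gen w L (V \ dimer k)) := by ring
      _ = _ := by rw [← e1, ← e2]; ring

/-- One dimer overhangs, so n sites meet n + 1 dimers; the bound on `a + n` makes the last label
legal. -/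
lemma admissible_Ico {L a n : ℕ} (ha : 1 ≤ a) (hn : 1 ≤ n) (h : a + n ≤ L + 1) :
    admissible L (Finset.Ico a (a + n)) = Finset.Ico a (a + (n + 1)) := by
  ext k
  simp only [mem_admissible, Finset.mem_Ico]
  omega

/-- Truncated subtraction covers the two overhanging dimers: `j = 0` leaves an empty left part, `j =
n` an empty right part. -/
lemma Ico_sdiff_dimer {a n j : ℕ} (ha : 1 ≤ a) (hj : j ≤ n) :
    Finset.Ico a (a + n) \ dimer (a + j)
      = Finset.Ico a (a + (j - 1)) ∪ Finset.Ico (a + j + 1) (a + j + 1 + (n - 1 - j)) := by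
  ext k
  simp only [dimer, Finset.mem_sdiff, Finset.mem_union, Finset.mem_Ico, Finset.mem_insert,
    Finset.mem_singleton]
  omega

lemma gen_Ico_zero (w : ℝ≥0∞) (L a : ℕ) : gen w L (Finset.Ico a (a + 0)) = 1 := by
  apply gen_of_empty
  simp [admissible]

/-- The recursion obtained by conditioning on the first dimer. -/
lemma gen_Ico_rec {w : ℝ≥0∞} {L a n : ℕ} (ha : 1 ≤ a) (hn : 1 ≤ n) (h : a + n ≤ L + 1) :
    ((n + 1 : ℕ) : ℝ≥0∞) * gen w L (Finset.Ico a (a + n))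
      = w * ∑ j ∈ Finset.range (n + 1), gen w L (Finset.Ico a (a + (j - 1))) *
        gen w L (Finset.Ico (a + j + 1) (a + j + 1 + (n - 1 - j))) := by
  have h1 := card_mul_gen w L (Finset.Ico a (a + n))
  rw [admissible_Ico ha hn h, Nat.card_Ico, Nat.add_sub_cancel_left,
    Finset.sum_Ico_eq_sum_range, Nat.add_sub_cancel_left] at h1
  rw [h1]
  congr 1
  refine Finset.sum_congr rfl fun j hj => ?_
  rw [Ico_sdiff_dimer ha (by simpa [Nat.lt_succ_iff] using hj)]
  refine gen_union L _ _ (Finset.disjoint_left.2 fun k hk => ?_)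
  rw [mem_admissible, Finset.mem_Ico, Finset.mem_Ico] at *
  omega

/-- The recursion involves neither the position nor the ambient length. The alternative `n = 0` is
needed because the empty remnant to the right of the last dimer may start beyond `L + 1`. -/
lemma gen_Ico_eq (w : ℝ≥0∞) (n : ℕ) : ∀ L a : ℕ, 1 ≤ a → (n = 0 ∨ a + n ≤ L + 1) →
    gen w L (Finset.Ico a (a + n)) = gen w n (Finset.Ico 1 (1 + n)) := by
  induction n using Nat.strong_induction_on with
  | _ n ih =>
    intro L a ha h
    rcases Nat.eq_zero_or_pos n with rfl | hn
    · rw [gen_Ico_zero, gen_Ico_zero]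
    have h' : a + n ≤ L + 1 := by omega
    refine (ENNReal.mul_right_inj (a := ((n + 1 : ℕ) : ℝ≥0∞)) (by simp)
      (ENNReal.natCast_ne_top _)).1 ?_
    rw [gen_Ico_rec ha hn h', gen_Ico_rec le_rfl hn (by omega)]
    congr 1
    refine Finset.sum_congr rfl fun j hj => ?_
    rw [Finset.mem_range] at hj
    rw [ih (j - 1) (by omega) L a ha (by omega), ih (j - 1) (by omega) n 1 le_rfl (by omega),
      ih (n - 1 - j) (by omega) L (a + j + 1) (by omega) (by omega),
      ih (n - 1 - j) (by omega) n (1 + j + 1) (by omega) (by omega)]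

/-- The generating function of the number of dimers on an interval of `n` sites. -/
noncomputable def genLen (w : ℝ≥0∞) (n : ℕ) : ℝ≥0∞ := gen w n (Finset.Icc 1 n)

lemma genLen_eq (w : ℝ≥0∞) (n : ℕ) : genLen w n = gen w n (Finset.Ico 1 (1 + n)) := by
  rw [genLen]
  congr 1
  ext k
  simp only [Finset.mem_Icc, Finset.mem_Ico]
  omega

lemma genLen_zero (w : ℝ≥0∞) : genLen w 0 = 1 := by rw [genLen_eq, gen_Ico_zero]

lemma genLen_rec (w : ℝ≥0∞) {n : ℕ} (hn : 1 ≤ n) :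
    ((n + 1 : ℕ) : ℝ≥0∞) * genLen w n
      = w * ∑ j ∈ Finset.range (n + 1), genLen w (j - 1) * genLen w (n - 1 - j) := by
  rw [genLen_eq, gen_Ico_rec le_rfl hn (by omega)]
  congr 1
  refine Finset.sum_congr rfl fun j hj => ?_
  rw [Finset.mem_range] at hj
  rw [gen_Ico_eq w (j - 1) n 1 le_rfl (by omega),
    gen_Ico_eq w (n - 1 - j) n (1 + j + 1) (by omega) (by omega), genLen_eq, genLen_eq]

lemma genLen_ne_top {w : ℝ≥0∞} (hw : w ≠ ∞) (n : ℕ) : genLen w n ≠ ∞ := gen_ne_top hw _ _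

/-! ### Exponential moments of the count and their recursion -/

lemma lintegral_exp_count (L : ℕ) (lam : ℝ) :
    ∫⁻ n, ENNReal.ofReal (Real.exp (lam * count n)) ∂(countLaw L)
      = genLen (ENNReal.ofReal (Real.exp lam)) L := by
  rw [lintegral_countable', genLen, gen]
  simp_rw [countLaw, PMF.toMeasure_apply_singleton _ _ (measurableSet_singleton _)]
  simp_rw [mul_comm _ (countPMF L _)]
  rw [countPMF, tsum_map_mul]
  refine tsum_congr fun l => ?_
  rw [count, mul_comm lam, Real.exp_nat_mul, ENNReal.ofReal_pow (Real.exp_pos _).le]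

lemma integrable_exp_count (L : ℕ) (lam : ℝ) :
    Integrable (fun n => Real.exp (lam * count n)) (countLaw L) := by
  refine ⟨Measurable.aestronglyMeasurable (measurable_of_countable _), ?_⟩
  rw [hasFiniteIntegral_iff_ofReal (ae_of_all _ fun _ => (Real.exp_pos _).le),
    lintegral_exp_count]
  exact (genLen_ne_top ENNReal.ofReal_ne_top _).lt_top

lemma F_eq_toReal (lam : ℝ) (L : ℕ) :
    F lam L = (genLen (ENNReal.ofReal (Real.exp lam)) L).toReal := by
  rw [F, mgf, integral_eq_lintegral_of_nonneg_ae (ae_of_all _ fun _ => (Real.exp_pos _).le)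
    (Measurable.aestronglyMeasurable (measurable_of_countable _)), lintegral_exp_count]

instance (L : ℕ) : IsProbabilityMeasure (countLaw L) := by
  unfold countLaw
  infer_instance

lemma F_pos (lam : ℝ) (L : ℕ) : 0 < F lam L := mgf_pos (integrable_exp_count L lam)

lemma F_zero (lam : ℝ) : F lam 0 = 1 := by rw [F_eq_toReal, genLen_zero]; simp

lemma F_rec (lam : ℝ) {n : ℕ} (hn : 1 ≤ n) :
    ((n + 1 : ℕ) : ℝ) * F lam n
      = Real.exp lam * ∑ j ∈ Finset.range (n + 1), F lam (j - 1) * F lam (n - 1 - j) := by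
  have h := congrArg ENNReal.toReal (genLen_rec (ENNReal.ofReal (Real.exp lam)) hn)
  rw [ENNReal.toReal_mul, ENNReal.toReal_mul, ENNReal.toReal_natCast,
    ENNReal.toReal_ofReal (Real.exp_pos _).le, ENNReal.toReal_sum (fun j _ => ENNReal.mul_ne_top
      (genLen_ne_top ENNReal.ofReal_ne_top _) (genLen_ne_top ENNReal.ofReal_ne_top _))] at h
  simpa only [ENNReal.toReal_mul, ← F_eq_toReal] using h

/-- The Taylor coefficients at `0` of the solution of `Ψ' = z Ψ² + 1 - z`, `Ψ(0) = 1`. -/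
noncomputable def coef (z : ℂ) : ℕ → ℂ
  | 0 => 1
  | n + 1 => (z * ∑ k : Fin (n + 1), coef z k * coef z (n - k) + if n = 0 then 1 - z else 0) /
      (n + 1)

lemma coef_zero (z : ℂ) : coef z 0 = 1 := by rw [coef]

lemma coef_succ (z : ℂ) (n : ℕ) : coef z (n + 1) =
    (z * ∑ k ∈ Finset.range (n + 1), coef z k * coef z (n - k) + if n = 0 then 1 - z else 0) /
      (n + 1) := by
  rw [coef, Finset.sum_range]

/-- With the index shifted by one, and F(-1) read as F(0) = 1 by truncation, the recursion is an
exact Cauchy product. Only the first step fails, and the term 1 - z corrects it. -/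
lemma F_eq_coef (lam : ℝ) (n : ℕ) : (F lam (n - 1) : ℂ) = coef (Complex.exp lam) n := by
  induction n using Nat.strong_induction_on with
  | _ n ih =>
    rcases n with _ | n
    · rw [coef_zero, F_zero, Complex.ofReal_one]
    rw [coef_succ, Nat.add_sub_cancel]
    have hn1 : ((n : ℂ) + 1) ≠ 0 := by exact_mod_cast n.succ_ne_zero
    rw [eq_div_iff hn1]
    rcases Nat.eq_zero_or_pos n with rfl | hn
    · simp [F_zero, coef_zero]
    rw [if_neg hn.ne', add_zero]
    have h := congrArg Complex.ofReal (F_rec lam hn)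
    push_cast at h
    rw [mul_comm, h]
    congr 1
    refine Finset.sum_congr rfl fun k hk => ?_
    rw [Finset.mem_range] at hk
    rw [ih k hk, ← ih (n - k) (by omega)]
    congr 3
    omega

end Combinatorics

/-! ### The Riccati equation: cotangent solution, Taylor coefficients and their asymptotics -/

section Riccati

open Complex

/-- The entire function `sin w / w`. -/
noncomputable def sincC : ℂ → ℂ := dslope Complex.sin 0

/-- The meromorphic function `w cot w`. -/
noncomputable def wcot (w : ℂ) : ℂ := Complex.cos w / sincC w

lemma mul_sincC (w : ℂ) : w * sincC w = Complex.sin w := by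
  simpa [sincC] using sub_smul_dslope Complex.sin 0 w

lemma sincC_zero : sincC 0 = 1 := by simp [sincC]

lemma differentiable_sincC : Differentiable ℂ sincC := by
  rw [← differentiableOn_univ, sincC, Complex.differentiableOn_dslope univ_mem]
  exact Complex.differentiable_sin.differentiableOn

lemma exists_int_of_sincC_eq_zero {w : ℂ} (h : sincC w = 0) : ∃ n : ℤ, n ≠ 0 ∧ w = n * Real.pi := by
  have h1 : Complex.sin w = 0 := by rw [← mul_sincC, h, mul_zero]
  obtain ⟨n, rfl⟩ := Complex.sin_eq_zero_iff.1 h1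
  refine ⟨n, ?_, rfl⟩
  rintro rfl
  simp [sincC_zero] at h

lemma sincC_ne_zero_of_norm_le {w : ℂ} (h : ‖w‖ ≤ 1) : sincC w ≠ 0 := by
  intro h0
  obtain ⟨n, hn, rfl⟩ := exists_int_of_sincC_eq_zero h0
  rw [norm_mul, Complex.norm_intCast, Complex.norm_real, Real.norm_of_nonneg Real.pi_pos.le] at h
  have h1 : (1 : ℝ) ≤ |(n : ℝ)| := by exact_mod_cast Int.one_le_abs hn
  nlinarith [Real.pi_gt_three]

lemma wcot_zero : wcot 0 = 1 := by simp [wcot, sincC_zero]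

lemma differentiableAt_wcot {w : ℂ} (h : sincC w ≠ 0) : DifferentiableAt ℂ wcot w :=
  Complex.differentiable_cos.differentiableAt.fun_div differentiable_sincC.differentiableAt h

lemma mul_deriv_sincC (w : ℂ) : w * deriv sincC w = Complex.cos w - sincC w := by
  have h1 := (hasDerivAt_id w).mul (differentiable_sincC w).hasDerivAt
  have h2 : (id * sincC) = Complex.sin := by
    ext x
    exact mul_sincC x
  rw [h2] at h1
  have h3 := h1.unique (Complex.hasDerivAt_sin w)
  simp only [id, one_mul] at h3
  rw [← h3]
  ring

/-- This is cot' = -1 - cot² rewritten for w cot w; the factor w keeps it valid at w = 0. -/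
lemma mul_deriv_wcot {w : ℂ} (h : sincC w ≠ 0) :
    w * deriv wcot w = wcot w - w ^ 2 - wcot w ^ 2 := by
  have h1 : HasDerivAt wcot _ w :=
    (Complex.hasDerivAt_cos w).fun_div (differentiable_sincC w).hasDerivAt h
  rw [h1.deriv, wcot, ← mul_sincC]
  have h2 := mul_deriv_sincC w
  field_simp
  linear_combination (- Complex.cos w) * h2

/-- The function `(w cot w - 1) / w`, analytic at `0`. -/
noncomputable def cotRem : ℂ → ℂ := dslope wcot 0

lemma wcot_eq (w : ℂ) : wcot w = 1 + w * cotRem w := by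
  have := sub_smul_dslope wcot 0 w
  rw [sub_zero, smul_eq_mul, wcot_zero] at this
  rw [cotRem, this]
  ring

lemma isOpen_sincC_ne_zero : IsOpen {w | sincC w ≠ 0} :=
  isOpen_ne_fun differentiable_sincC.continuous continuous_const

lemma differentiableAt_cotRem {w : ℂ} (h : sincC w ≠ 0) : DifferentiableAt ℂ cotRem w := by
  have h0 : {w | sincC w ≠ 0} ∈ 𝓝 (0 : ℂ) :=
    isOpen_sincC_ne_zero.mem_nhds (by simp [sincC_zero])
  refine ((Complex.differentiableOn_dslope h0).2 fun x hx => ?_).differentiableAt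
    (isOpen_sincC_ne_zero.mem_nhds h)
  exact (differentiableAt_wcot hx).differentiableWithinAt

/-- The function `z⁻¹ Λ cot (Λ (y - x))` of `x`. -/
noncomputable def ricc (z Λ y x : ℂ) : ℂ := wcot (Λ * (y - x)) / (z * (y - x))

/-- Differentiating z⁻¹Λ cot(Λ(y - x)) in x gives z⁻¹Λ²(1 + cot²), and Λ² = z(1 - z) makes this 1 -
z plus z times the square of the function. -/
lemma hasDerivAt_ricc {z Λ y x : ℂ} (hz : z ≠ 0) (hΛ : Λ ^ 2 = z * (1 - z)) (hx : x ≠ y)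
    (h : sincC (Λ * (y - x)) ≠ 0) :
    HasDerivAt (ricc z Λ y) (z * ricc z Λ y x ^ 2 + (1 - z)) x := by
  have hv : y - x ≠ 0 := sub_ne_zero.2 hx.symm
  have h1 : HasDerivAt (fun x => y - x) (-1) x := by
    simpa using (hasDerivAt_id x).const_sub y
  have h2 := (differentiableAt_wcot h).hasDerivAt.comp x (h1.const_mul Λ)
  have h3 := h2.fun_div (h1.const_mul z) (mul_ne_zero hz hv)
  refine h3.congr_deriv ?_
  have h4 := mul_deriv_wcot h
  simp only [ricc, Function.comp_apply]
  field_simp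
  linear_combination (-1 : ℂ) * h4 + (y - x) ^ 2 * hΛ

/-- Splits off the pole at x = y; the remainder is regular there. -/
lemma ricc_eq {z Λ y x : ℂ} (hz : z ≠ 0) (hx : x ≠ y) :
    ricc z Λ y x = z⁻¹ * (y - x)⁻¹ + z⁻¹ * Λ * cotRem (Λ * (y - x)) := by
  have hv : y - x ≠ 0 := sub_ne_zero.2 hx.symm
  rw [ricc, wcot_eq]
  field_simp

open Nat in
-- By Leibniz' rule, repeated differentiation of the equation reproduces the recursion defining
-- `coef`, so equation and initial value determine every Taylor coefficient.
lemma iteratedDeriv_riccati {z : ℂ} {f : ℂ → ℂ} (hf : AnalyticAt ℂ f 0) (h0 : f 0 = 1)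
    (h : ∀ᶠ x in 𝓝 (0 : ℂ), deriv f x = z * f x ^ 2 + (1 - z)) (n : ℕ) :
    iteratedDeriv n f 0 = n ! * coef z n := by
  induction n using Nat.strong_induction_on with
  | _ n ih =>
    rcases n with _ | n
    · simp [h0, coef_zero]
    have e : deriv f =ᶠ[𝓝 0] fun x => z * (f x * f x) + (1 - z) :=
      h.mono fun x hx => by rw [hx]; ring
    have hc : ContDiffAt ℂ n f 0 := hf.contDiffAt
    rw [iteratedDeriv_succ', e.iteratedDeriv_eq,
      iteratedDeriv_fun_add (contDiffAt_const.mul (hc.mul hc)) contDiffAt_const,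
      iteratedDeriv_const_mul_field, iteratedDeriv_fun_mul hc hc, iteratedDeriv_const, coef_succ]
    have hn1 : ((n : ℂ) + 1) ≠ 0 := by exact_mod_cast n.succ_ne_zero
    have hsum : ∑ i ∈ Finset.range (n + 1), (n.choose i : ℂ) * iteratedDeriv i f 0
        * iteratedDeriv (n - i) f 0
        = n ! * ∑ k ∈ Finset.range (n + 1), coef z k * coef z (n - k) := by
      rw [Finset.mul_sum]
      refine Finset.sum_congr rfl fun i hi => ?_
      rw [Finset.mem_range] at hi
      rw [ih i hi, ih (n - i) (by omega),
        ← Nat.choose_mul_factorial_mul_factorial (Nat.lt_succ_iff.1 hi)]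
      push_cast
      ring
    rw [hsum, Nat.factorial_succ]
    push_cast
    rcases Nat.eq_zero_or_pos n with rfl | hn
    · simp
    · simp only [hn.ne', if_false]
      field_simp
      ring

lemma iteratedDeriv_const_sub_inv (y : ℂ) (n : ℕ) :
    iteratedDeriv n (fun x => (y - x)⁻¹) 0 = n.factorial * (y ^ (n + 1))⁻¹ := by
  have h1 := iteratedDeriv_comp_const_sub n (fun x : ℂ => x⁻¹) y
  rw [h1]
  simp only [sub_zero]
  rw [iteratedDeriv_eq_iterate]
  have h2 := iter_deriv_inv (𝕜 := ℂ) n y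
  have h3 : (fun x : ℂ => x⁻¹) = Inv.inv := rfl
  rw [h3, h2, smul_eq_mul, ← mul_assoc, ← mul_assoc, ← mul_pow]
  simp only [mul_neg, mul_one, neg_neg, one_pow, one_mul]
  congr 1
  rw [← zpow_natCast, ← zpow_neg]
  congr 1
  push_cast
  ring

/-- The hypotheses under which `ricc z Λ y` solves `Ψ' = z Ψ² + 1 - z`, `Ψ(0) = 1` near `0`. -/
structure IsParam (z Λ y : ℂ) : Prop where
  z_ne : z ≠ 0
  y_ne : y ≠ 0
  sq : Λ ^ 2 = z * (1 - z)
  sinc_ne : sincC (Λ * y) ≠ 0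
  init : wcot (Λ * y) = z * y

namespace IsParam

variable {z Λ y : ℂ}

lemma ricc_zero (H : IsParam z Λ y) : ricc z Λ y 0 = 1 := by
  rw [ricc, sub_zero, H.init, div_self (mul_ne_zero H.z_ne H.y_ne)]

lemma eventually_sincC (H : IsParam z Λ y) : ∀ᶠ x in 𝓝 (0 : ℂ), sincC (Λ * (y - x)) ≠ 0 := by
  have hc : Continuous fun x => sincC (Λ * (y - x)) :=
    differentiable_sincC.continuous.comp (by fun_prop)
  exact hc.continuousAt.eventually_ne (by simpa using H.sinc_ne)

lemma iteratedDeriv_ricc (H : IsParam z Λ y) (n : ℕ) :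
    iteratedDeriv n (ricc z Λ y) 0 = n.factorial * coef z n := by
  have h1 : ∀ᶠ x in 𝓝 (0 : ℂ), HasDerivAt (ricc z Λ y) (z * ricc z Λ y x ^ 2 + (1 - z)) x := by
    filter_upwards [H.eventually_sincC, eventually_ne_nhds H.y_ne.symm] with x h2 h3
    exact hasDerivAt_ricc H.z_ne H.sq h3 h2
  refine iteratedDeriv_riccati ?_ H.ricc_zero (h1.mono fun x hx => hx.deriv) n
  exact Complex.analyticAt_iff_eventually_differentiableAt.2 (h1.mono fun x hx => hx.differentiableAt)

/-- A function holomorphic on a disc is the sum of its Taylor series there. The bound `r ≤ ‖y‖`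
excludes the pole x = y, which the condition on `sincC` does not detect since `sincC 0 = 1`. -/
lemma hasSum_coef (H : IsParam z Λ y) {r : ℝ} (hr : r ≤ ‖y‖)
    (h : ∀ x, ‖x‖ < r → sincC (Λ * (y - x)) ≠ 0) {x : ℂ} (hx : ‖x‖ < r) :
    HasSum (fun n => coef z n * x ^ n) (ricc z Λ y x) := by
  have hd : DifferentiableOn ℂ (ricc z Λ y) (Metric.ball 0 r) := by
    intro x hx
    rw [mem_ball_zero_iff] at hx
    refine (hasDerivAt_ricc H.z_ne H.sq ?_ (h x hx)).differentiableAt.differentiableWithinAt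
    rintro rfl
    exact absurd hx (not_lt.2 hr)
  have h1 := Complex.hasSum_taylorSeries_on_ball hd (z := x) (by simpa using hx)
  refine h1.congr_fun fun n => ?_
  have h2 : (n.factorial : ℂ) ≠ 0 := by exact_mod_cast n.factorial_ne_zero
  rw [H.iteratedDeriv_ricc, sub_zero, smul_eq_mul, smul_eq_mul]
  field_simp

/-- The pole contributes exactly z⁻¹ y^(-n-1), and Cauchy's estimate bounds the coefficients of the
remainder. The remainder is regular at y, so ρ may exceed ‖y‖, which makes the pole dominant. -/
lemma norm_coef_sub_le (H : IsParam z Λ y) {ρ C : ℝ} (hρ : 0 < ρ)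
    (h : ∀ x, ‖x‖ ≤ ρ → sincC (Λ * (y - x)) ≠ 0)
    (hC : ∀ x, ‖x‖ = ρ → ‖z⁻¹ * Λ * cotRem (Λ * (y - x))‖ ≤ C) (n : ℕ) :
    ‖coef z n - z⁻¹ * (y ^ (n + 1))⁻¹‖ ≤ C / ρ ^ n := by
  set R : ℂ → ℂ := fun x => z⁻¹ * Λ * cotRem (Λ * (y - x)) with hR
  have hd : ∀ x, ‖x‖ ≤ ρ → DifferentiableAt ℂ R x := fun x hx =>
    ((differentiableAt_cotRem (h x hx)).comp x (by fun_prop)).const_mul _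
  have hdc : DiffContOnCl ℂ R (Metric.ball 0 ρ) := by
    refine DifferentiableOn.diffContOnCl fun x hx => (hd x ?_).differentiableWithinAt
    rw [closure_ball _ hρ.ne'] at hx
    simpa using hx
  have hRa : AnalyticAt ℂ R 0 := by
    refine (DifferentiableOn.analyticAt (s := Metric.ball 0 ρ) ?_ (Metric.ball_mem_nhds 0 hρ))
    exact hdc.differentiableOn
  have hb := Complex.norm_iteratedDeriv_le_of_forall_mem_sphere_norm_le n hρ hdc
    (C := C) (fun x hx => hC x (by simpa using hx))
  have he : ricc z Λ y =ᶠ[𝓝 0] fun x => z⁻¹ * (y - x)⁻¹ + R x := by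
    filter_upwards [eventually_ne_nhds H.y_ne.symm] with x hx
    exact ricc_eq H.z_ne hx
  have ha : AnalyticAt ℂ (fun x => (y - x)⁻¹) 0 :=
    (analyticAt_const.sub analyticAt_id).inv (by simpa using H.y_ne)
  have hpa : AnalyticAt ℂ (fun x => z⁻¹ * (y - x)⁻¹) 0 := analyticAt_const.mul ha
  have hi : iteratedDeriv n R 0
      = n.factorial * (coef z n - z⁻¹ * (y ^ (n + 1))⁻¹) := by
    have h1 := H.iteratedDeriv_ricc n
    rw [he.iteratedDeriv_eq, iteratedDeriv_fun_add
      hpa.contDiffAt hRa.contDiffAt, iteratedDeriv_const_mul_field, iteratedDeriv_const_sub_inv] at h1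
    linear_combination h1
  rw [hi, norm_mul, Complex.norm_natCast, mul_div_assoc] at hb
  exact le_of_mul_le_mul_left hb (by exact_mod_cast n.factorial_pos)

lemma norm_scaled_coef_sub_one_le (H : IsParam z Λ y) {ρ C : ℝ} (hρ : 0 < ρ)
    (h : ∀ x, ‖x‖ ≤ ρ → sincC (Λ * (y - x)) ≠ 0)
    (hC : ∀ x, ‖x‖ = ρ → ‖z⁻¹ * Λ * cotRem (Λ * (y - x))‖ ≤ C) (n : ℕ) :
    ‖z * y ^ (n + 1) * coef z n - 1‖ ≤ ‖z‖ * ‖y‖ * C * (‖y‖ / ρ) ^ n := by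
  have hz := H.z_ne
  have hy := H.y_ne
  have e : z * y ^ (n + 1) * coef z n - 1
      = z * y ^ (n + 1) * (coef z n - z⁻¹ * (y ^ (n + 1))⁻¹) := by
    field_simp
  rw [e, norm_mul, norm_mul, norm_pow]
  refine (mul_le_mul_of_nonneg_left (H.norm_coef_sub_le hρ h hC n) (by positivity)).trans_eq ?_
  rw [div_pow]
  ring

end IsParam

end Riccati

/-! ### Real λ: the dominant pole, the closed form and the growth rate -/

section RealParameter

open Complex

/-- Here Λ = zt and Λy = θ with tan θ = t, so θ cot θ = θ/t = zy. The relation z(1 + t²) = 1 gives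
Λ² = z(1 - z) and excludes t = ±i, the singular points of the arctangent. -/
lemma isParam_arctan {z t : ℂ} (hz : z * (1 + t ^ 2) = 1) (ht : t ≠ 0) :
    IsParam z (z * t) (arctan t / (z * t)) := by
  have hz0 : z ≠ 0 := left_ne_zero_of_mul_eq_one hz
  have h1 : t ≠ I := by
    rintro rfl
    simp at hz
  have h2 : t ≠ -I := by
    rintro rfl
    simp at hz
  have htan := tan_arctan h1 h2
  have hs : Complex.sin (arctan t) ≠ 0 := by
    intro h
    rw [Complex.tan_eq_sin_div_cos, h, zero_div] at htan
    exact ht htan.symm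
  have ha : arctan t ≠ 0 := by
    intro h
    simp [h] at hs
  have hc : Complex.cos (arctan t) ≠ 0 := by
    intro h
    rw [Complex.tan_eq_sin_div_cos, h, div_zero] at htan
    exact ht htan.symm
  have e : z * t * (arctan t / (z * t)) = arctan t := mul_div_cancel₀ _ (mul_ne_zero hz0 ht)
  have hsc : sincC (arctan t) ≠ 0 := by
    intro h
    rw [← mul_sincC, h, mul_zero] at hs
    exact hs rfl
  refine ⟨hz0, div_ne_zero ha (mul_ne_zero hz0 ht), ?_, by rwa [e], ?_⟩
  · linear_combination z * hz
  · rw [e, wcot, div_eq_iff hsc]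
    have h3 : z * (arctan t / (z * t)) = arctan t / t := by field_simp
    rw [Complex.tan_eq_sin_div_cos, div_eq_iff hc] at htan
    rw [h3, div_mul_eq_mul_div, mul_sincC, eq_div_iff ht, htan, mul_comm]

lemma root_sq (lam : ℝ) : root lam ^ 2 = 1 - Complex.exp lam := by
  rw [root, ← Complex.cpow_nat_mul]
  norm_num

/-- The argument `e^{-λ/2} √(1 - e^λ)` of the arctangent. -/
noncomputable def arg (lam : ℝ) : ℂ := Complex.exp (-lam / 2) * root lam

lemma exp_mul_arg (lam : ℝ) : Complex.exp lam * arg lam = Lam lam := by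
  rw [arg, Lam, ← mul_assoc, ← Complex.exp_add]
  congr 2
  ring

lemma arg_sq (lam : ℝ) : arg lam ^ 2 = Complex.exp (-lam) - 1 := by
  rw [arg, mul_pow, root_sq, ← Complex.exp_nat_mul, mul_sub, mul_one, ← Complex.exp_add]
  congr 1
  · congr 1
    push_cast
    ring
  · rw [show ((2 : ℕ) : ℂ) * (-lam / 2) + lam = 0 by push_cast; ring, Complex.exp_zero]

lemma exp_mul_one_add_arg_sq (lam : ℝ) : Complex.exp lam * (1 + arg lam ^ 2) = 1 := by
  rw [arg_sq, add_sub_cancel, ← Complex.exp_add, add_neg_cancel, Complex.exp_zero]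

lemma arctan_ofReal_mul_I {τ : ℝ} (h0 : 0 < τ) (h1 : τ < 1) :
    arctan (τ * I) = ((Real.log ((1 + τ) / (1 - τ)) / 2 : ℝ) : ℂ) * I := by
  have h2 : (1 + τ * I * I) / (1 - τ * I * I) = (((1 - τ) / (1 + τ) : ℝ) : ℂ) := by
    rw [mul_assoc, I_mul_I]
    push_cast
    ring
  have h3 : 0 ≤ (1 - τ) / (1 + τ) := div_nonneg (by linarith) (by linarith)
  rw [arctan, h2, ← Complex.ofReal_log h3, ← inv_div (1 + τ) (1 - τ), Real.log_inv]
  push_cast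
  ring

lemma root_of_neg {lam : ℝ} (h : lam < 0) : root lam = (Real.sqrt (1 - Real.exp lam) : ℝ) := by
  have h1 : 0 ≤ 1 - Real.exp lam := by simpa using h.le
  rw [root, Real.sqrt_eq_rpow, Complex.ofReal_cpow h1]
  push_cast
  rfl

lemma root_of_pos {lam : ℝ} (h : 0 < lam) :
    root lam = (Real.sqrt (Real.exp lam - 1) : ℝ) * I := by
  have h1 : 1 - Real.exp lam ≤ 0 := by simpa using h.le
  have h2 := Complex.ofReal_cpow_of_nonpos h1 (1 / 2 : ℂ)
  have h3 : (0 : ℝ) ≤ Real.exp lam - 1 := by linarith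
  rw [root]
  push_cast at h2
  have h4 : Complex.exp (Real.pi * I * (1 / 2)) = I := by
    rw [show (Real.pi * I * (1 / 2) : ℂ) = Real.pi / 2 * I by ring, Complex.exp_pi_div_two_mul_I]
  rw [h2, h4, Real.sqrt_eq_rpow, Complex.ofReal_cpow h3]
  push_cast
  rw [neg_sub]

/-- For λ < 0 all quantities are real. For λ > 0 both arctangent and Λ are purely imaginary and the
factor i cancels. The bound on the real part is what later singles out the dominant pole. -/
lemma exists_arctan_arg {lam : ℝ} (h : lam ≠ 0) :
    ∃ p : ℝ, 0 < p ∧ arctan (arg lam) / Lam lam = p ∧ |(arctan (arg lam)).re| < Real.pi / 2 := by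
  rcases lt_or_gt_of_ne h with h | h
  · set τ : ℝ := Real.exp (-lam / 2) * Real.sqrt (1 - Real.exp lam) with hτ
    have hτ0 : 0 < τ := mul_pos (Real.exp_pos _) (Real.sqrt_pos.2 (by simpa using h))
    have ha : arg lam = τ := by rw [arg, root_of_neg h, hτ]; push_cast; rfl
    refine ⟨Real.arctan τ / (Real.exp lam * τ),
      div_pos (Real.arctan_pos.2 hτ0) (mul_pos (Real.exp_pos _) hτ0), ?_, ?_⟩
    · rw [← exp_mul_arg, ha, ← Complex.ofReal_arctan]
      push_cast
      rfl
    · rw [ha, ← Complex.ofReal_arctan, Complex.ofReal_re, abs_lt]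
      exact ⟨Real.neg_pi_div_two_lt_arctan τ, Real.arctan_lt_pi_div_two τ⟩
  · set τ : ℝ := Real.exp (-lam / 2) * Real.sqrt (Real.exp lam - 1) with hτ
    have h1 : 0 < Real.exp lam - 1 := by simpa using h
    have hτ0 : 0 < τ := mul_pos (Real.exp_pos _) (Real.sqrt_pos.2 h1)
    have ha : arg lam = τ * I := by
      rw [arg, root_of_pos h, hτ]
      push_cast
      ring
    -- The relation e^λ(1 - τ²) = 1 forces 1 - τ² > 0.
    have hτ1 : τ < 1 := by
      have h2 := exp_mul_one_add_arg_sq lam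
      rw [ha, mul_pow, I_sq] at h2
      have h3 : Real.exp lam * (1 + τ ^ 2 * (-1)) = 1 := by exact_mod_cast h2
      by_contra! h4
      have h5 : 1 + τ ^ 2 * (-1) ≤ 0 := by nlinarith
      linarith [mul_nonpos_of_nonneg_of_nonpos (Real.exp_pos lam).le h5]
    have hlog : 0 < Real.log ((1 + τ) / (1 - τ)) :=
      Real.log_pos ((one_lt_div (by linarith)).2 (by linarith))
    refine ⟨Real.log ((1 + τ) / (1 - τ)) / 2 / (Real.exp lam * τ),
      div_pos (by positivity) (mul_pos (Real.exp_pos _) hτ0), ?_, ?_⟩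
    · rw [← exp_mul_arg, ha, arctan_ofReal_mul_I hτ0 hτ1, ← mul_assoc,
        mul_div_mul_right _ _ I_ne_zero]
      push_cast
      rfl
    · rw [ha, arctan_ofReal_mul_I hτ0 hτ1, Complex.re_ofReal_mul, I_re, mul_zero, abs_zero]
      exact Real.pi_div_two_pos

lemma y_zero : y 0 = 1 := by rw [y, if_pos rfl]

lemma y_eq {lam : ℝ} (h : lam ≠ 0) : (y lam : ℂ) = arctan (arg lam) / Lam lam := by
  obtain ⟨p, -, h1, -⟩ := exists_arctan_arg h
  rw [y, if_neg h, ← arg, h1, Complex.ofReal_re]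

lemma y_pos (lam : ℝ) : 0 < y lam := by
  rcases eq_or_ne lam 0 with rfl | h
  · rw [y_zero]
    exact one_pos
  obtain ⟨p, h0, h1, -⟩ := exists_arctan_arg h
  rwa [y, if_neg h, ← arg, h1, Complex.ofReal_re]

lemma norm_y (lam : ℝ) : ‖(y lam : ℂ)‖ = y lam := by
  rw [Complex.norm_real, Real.norm_of_nonneg (y_pos lam).le]

lemma root_zero : root 0 = 0 := by
  have := root_sq 0
  simpa using this

lemma Lam_zero : Lam 0 = 0 := by rw [Lam, root_zero, mul_zero]

lemma arg_ne_zero {lam : ℝ} (h : lam ≠ 0) : arg lam ≠ 0 := by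
  intro h0
  have h1 := exp_mul_one_add_arg_sq lam
  rw [h0, zero_pow two_ne_zero, add_zero, mul_one] at h1
  exact h (Real.exp_eq_one_iff lam |>.1 (by exact_mod_cast h1))

lemma Lam_ne_zero {lam : ℝ} (h : lam ≠ 0) : Lam lam ≠ 0 := by
  rw [← exp_mul_arg]
  exact mul_ne_zero (Complex.exp_ne_zero _) (arg_ne_zero h)

lemma isParam (lam : ℝ) : IsParam (Complex.exp lam) (Lam lam) (y lam) := by
  rcases eq_or_ne lam 0 with rfl | h
  · rw [Lam_zero, y_zero]
    constructor <;> simp [sincC_zero, wcot_zero]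
  · rw [y_eq h, ← exp_mul_arg]
    exact isParam_arctan (exp_mul_one_add_arg_sq lam) (arg_ne_zero h)

lemma abs_re_Lam_mul_y_lt (lam : ℝ) : |(Lam lam * y lam).re| < Real.pi / 2 := by
  rcases eq_or_ne lam 0 with rfl | h
  · rw [Lam_zero, zero_mul, Complex.zero_re, abs_zero]
    exact Real.pi_div_two_pos
  obtain ⟨p, -, -, h2⟩ := exists_arctan_arg h
  rwa [y_eq h, mul_div_cancel₀ _ (Lam_ne_zero h)]

lemma norm_lt_norm_sub_int_mul_pi {θ : ℂ} (h : |θ.re| < Real.pi / 2) {n : ℤ} (hn : n ≠ 0) :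
    ‖θ‖ < ‖θ - n * Real.pi‖ := by
  rw [← sq_lt_sq₀ (norm_nonneg _) (norm_nonneg _), Complex.sq_norm, Complex.sq_norm,
    Complex.normSq_apply, Complex.normSq_apply]
  have e1 : (θ - n * Real.pi).re = θ.re - n * Real.pi := by simp
  have e2 : (θ - n * Real.pi).im = θ.im := by simp
  rw [e1, e2]
  have h1 : (1 : ℝ) ≤ |(n : ℝ)| := by exact_mod_cast Int.one_le_abs hn
  have h2 : n * θ.re ≤ |(n : ℝ)| * |θ.re| := (le_abs_self _).trans_eq (abs_mul _ _)
  have h3 : |(n : ℝ)| * |(n : ℝ)| = n * n := abs_mul_abs_self _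
  have h4 : |(n : ℝ)| * |θ.re| < |(n : ℝ)| * (Real.pi / 2) :=
    mul_lt_mul_of_pos_left h (by linarith)
  have h5 : |(n : ℝ)| * (Real.pi / 2) ≤ |(n : ℝ)| * |(n : ℝ)| * (Real.pi / 2) :=
    mul_le_mul_of_nonneg_right (le_mul_of_one_le_left (abs_nonneg _) h1) Real.pi_div_two_pos.le
  rw [h3] at h5
  -- This is half of |θ - nπ|² - |θ|² = n²π² - 2nπ Re θ.
  have h6 : 0 < Real.pi * (n * n * (Real.pi / 2) - n * θ.re) :=
    mul_pos Real.pi_pos (by linarith)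
  linarith

/-- At a zero, Λx = Λy - nπ with n ≠ 0, which has larger modulus than Λy, contradicting |x| ≤ y. So
y is the only pole of the solution in the closed disc. -/
lemma sincC_ne_zero_of_norm_le_y {lam : ℝ} {x : ℂ} (hx : ‖x‖ ≤ y lam) :
    sincC (Lam lam * (y lam - x)) ≠ 0 := by
  intro h
  obtain ⟨n, hn, h1⟩ := exists_int_of_sincC_eq_zero h
  have h2 := norm_lt_norm_sub_int_mul_pi (abs_re_Lam_mul_y_lt lam) hn
  rw [← h1, mul_sub, sub_sub_cancel, norm_mul, norm_mul, norm_y] at h2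
  exact absurd (mul_le_mul_of_nonneg_left hx (norm_nonneg (Lam lam))) (not_le.2 h2)

/-- The closed disc is compact and the good set open, so the disc can be enlarged slightly; this gap
drives the geometric error decay. -/
lemma exists_radius (lam : ℝ) :
    ∃ ρ, y lam < ρ ∧ ∀ x : ℂ, ‖x‖ ≤ ρ → sincC (Lam lam * (y lam - x)) ≠ 0 := by
  have hO : IsOpen {x : ℂ | sincC (Lam lam * (y lam - x)) ≠ 0} :=
    isOpen_sincC_ne_zero.preimage (by fun_prop)
  obtain ⟨δ, hδ, hsub⟩ := (isCompact_closedBall (0 : ℂ) (y lam)).exists_cthickening_subset_open hO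
    fun x hx => sincC_ne_zero_of_norm_le_y (by simpa using hx)
  rw [cthickening_closedBall hδ.le (y_pos lam).le] at hsub
  exact ⟨y lam + δ, by linarith, fun x hx => hsub (by simpa [add_comm] using hx)⟩

lemma closedForm_eq {lam : ℝ} (hlam : lam ≠ 0) {x : ℂ} (hx : x ≠ y lam)
    (hc : Complex.cos (Lam lam * x) ≠ 0) (hs : sincC (Lam lam * (y lam - x)) ≠ 0) :
    Lam lam - Complex.exp lam * Complex.tan (Lam lam * x) ≠ 0 ∧
      closedForm lam x = ricc (Complex.exp lam) (Lam lam) (y lam) x - 1 := by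
  have H := isParam lam
  have hΛ := Lam_ne_zero hlam
  rw [closedForm]
  set z := Complex.exp lam
  set Λ := Lam lam
  set Y := ((y lam : ℝ) : ℂ)
  have hz := H.z_ne
  have hv : Y - x ≠ 0 := sub_ne_zero.2 hx.symm
  have h1 : Λ * Complex.cos (Λ * Y) = z * Complex.sin (Λ * Y) := by
    have h := H.init
    rw [wcot, div_eq_iff H.sinc_ne] at h
    rw [h, ← mul_sincC]
    ring
  have hsin : Complex.sin (Λ * (Y - x)) ≠ 0 := by
    rw [← mul_sincC]
    exact mul_ne_zero (mul_ne_zero hΛ hv) hs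
  have hY : Complex.sin (Λ * Y) ≠ 0 := by
    rw [← mul_sincC]
    exact mul_ne_zero (mul_ne_zero hΛ H.y_ne) H.sinc_ne
  -- The initial condition Λ cos(Λy) = z sin(Λy) and the addition formula turn the denominator into
  -- a multiple of sin(Λ(y - x)), which shows that it does not vanish.
  have h2 : Complex.sin (Λ * Y) * (Λ * Complex.cos (Λ * x) - z * Complex.sin (Λ * x))
      = Λ * Complex.sin (Λ * (Y - x)) := by
    rw [mul_sub Λ, Complex.sin_sub]
    linear_combination Complex.sin (Λ * x) * h1
  have hD : Λ * Complex.cos (Λ * x) - z * Complex.sin (Λ * x) ≠ 0 := by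
    intro h
    rw [h, mul_zero] at h2
    exact mul_ne_zero hΛ hsin h2.symm
  have h3 : Λ - z * Complex.tan (Λ * x)
      = (Λ * Complex.cos (Λ * x) - z * Complex.sin (Λ * x)) / Complex.cos (Λ * x) := by
    rw [Complex.tan_eq_sin_div_cos]
    field_simp
  have h4 : ricc z Λ Y x = Λ * Complex.cos (Λ * (Y - x)) / (z * Complex.sin (Λ * (Y - x))) := by
    rw [ricc, wcot, ← mul_sincC]
    field_simp
  rw [h3]
  refine ⟨div_ne_zero hD hc, ?_⟩
  rw [h4, Complex.tan_eq_sin_div_cos, div_div_div_cancel_right₀ hc,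
    div_sub_one (mul_ne_zero hz hsin), div_eq_div_iff hD (mul_ne_zero hz hsin)]
  refine mul_left_cancel₀ hY (mul_left_cancel₀ hΛ ?_)
  -- The matching identity for the numerator of `ricc - 1`; this is where Λ² = z(1 - z) enters.
  have h5 : Λ * (Λ * Complex.cos (Λ * (Y - x)) - z * Complex.sin (Λ * (Y - x)))
      = z * Complex.sin (Λ * x) * Complex.sin (Λ * Y) := by
    rw [mul_sub Λ Y, Complex.sin_sub, Complex.cos_sub]
    linear_combination (Λ * Complex.cos (Λ * x) + z * Complex.sin (Λ * x)) * h1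
      + Complex.sin (Λ * Y) * Complex.sin (Λ * x) * H.sq
  linear_combination (-(Λ * Complex.sin (Λ * (Y - x)))) * h5
    - Λ * (Λ * Complex.cos (Λ * (Y - x)) - z * Complex.sin (Λ * (Y - x))) * h2

lemma hasSum_F (lam : ℝ) {x : ℂ} (hx : ‖x‖ < y lam) :
    HasSum (fun L : ℕ => (F lam L : ℂ) * x ^ (L + 1))
      (ricc (Complex.exp lam) (Lam lam) (y lam) x - 1) := by
  have h := (isParam lam).hasSum_coef (norm_y lam).ge
    (fun x hx => sincC_ne_zero_of_norm_le_y hx.le) hx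
  rw [← hasSum_nat_add_iff' 1] at h
  simp only [Finset.range_one, Finset.sum_singleton, coef_zero, pow_zero, mul_one] at h
  refine h.congr_fun fun L => ?_
  rw [← F_eq_coef, Nat.add_sub_cancel]

lemma ne_y_of_norm_lt {lam : ℝ} {x : ℂ} (hx : ‖x‖ < y lam) : x ≠ y lam := by
  rintro rfl
  rw [norm_y] at hx
  exact lt_irrefl _ hx

lemma ricc_one_zero (x : ℂ) (hx : x ≠ 1) : ricc 1 0 1 x - 1 = x / (1 - x) := by
  have h : 1 - x ≠ 0 := sub_ne_zero.2 hx.symm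
  rw [ricc, zero_mul, wcot_zero, one_mul]
  field_simp
  ring

lemma meromorphicOrderAt_closedForm {lam : ℝ} (hlam : lam ≠ 0) :
    meromorphicOrderAt (closedForm lam) (y lam : ℂ) = ((-1 : ℤ) : WithTop ℤ) := by
  have H := isParam lam
  have hm : MeromorphicAt (closedForm lam) (y lam : ℂ) := by
    unfold closedForm Complex.tan
    fun_prop
  rw [meromorphicOrderAt_eq_int_iff hm]
  have hs0 : sincC (Lam lam * (y lam - y lam)) ≠ 0 := by simp [sincC_zero]
  have hsO : ∀ᶠ x in 𝓝 (y lam : ℂ), sincC (Lam lam * (y lam - x)) ≠ 0 :=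
    (isOpen_sincC_ne_zero.preimage (by fun_prop)).mem_nhds hs0
  have hc0 : Complex.cos (Lam lam * y lam) ≠ 0 := by
    have h := H.init
    rw [wcot, div_eq_iff H.sinc_ne] at h
    rw [h]
    exact mul_ne_zero (mul_ne_zero H.z_ne H.y_ne) H.sinc_ne
  have hcO : ∀ᶠ x in 𝓝 (y lam : ℂ), Complex.cos (Lam lam * x) ≠ 0 :=
    ContinuousAt.eventually_ne (by fun_prop) hc0
  -- The witness is (x - y) times the closed form, with value -1/z ≠ 0 at x = y.
  refine ⟨fun x => -(wcot (Lam lam * (y lam - x)) / Complex.exp lam) - (x - y lam), ?_, ?_, ?_⟩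
  · refine Complex.analyticAt_iff_eventually_differentiableAt.2 ?_
    filter_upwards [hsO] with x hx
    have := (differentiableAt_wcot hx).comp x
      (by fun_prop : DifferentiableAt ℂ (fun x => Lam lam * (y lam - x)) x)
    exact (this.div_const _).neg.sub (by fun_prop)
  · simp [wcot_zero]
  · rw [eventually_nhdsWithin_iff]
    filter_upwards [hsO, hcO] with x h1 h2 hx
    rw [(closedForm_eq hlam hx h2 h1).2, ricc, zpow_neg_one, smul_eq_mul]
    have h3 : x - y lam ≠ 0 := sub_ne_zero.2 hx
    have h4 : (y lam : ℂ) - x ≠ 0 := sub_ne_zero.2 (Ne.symm hx)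
    have h5 := H.z_ne
    have h6 : (y lam : ℂ) - x = -(x - y lam) := by ring
    rw [h6]
    field_simp

lemma meromorphicOrderAt_zero_case :
    meromorphicOrderAt (fun x : ℂ => x / (1 - x)) (y 0 : ℂ) = ((-1 : ℤ) : WithTop ℤ) := by
  have hm : MeromorphicAt (fun x : ℂ => x / (1 - x)) (y 0 : ℂ) := by fun_prop
  rw [meromorphicOrderAt_eq_int_iff hm, y_zero]
  refine ⟨fun x => -x, by fun_prop, by simp, ?_⟩
  rw [eventually_nhdsWithin_iff]
  refine Eventually.of_forall fun x hx => ?_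
  have h3 : x - 1 ≠ 0 := sub_ne_zero.2 (by simpa using hx)
  have h4 : 1 - x ≠ 0 := sub_ne_zero.2 (Ne.symm (by simpa using hx))
  simp only [Complex.ofReal_one, zpow_neg_one, smul_eq_mul]
  field_simp
  ring

/-- The exponent is L + 2 because F(λ, L) is the coefficient of index L + 1 and the n-th coefficient
behaves like z⁻¹ y^(-n-1). -/
lemma tendsto_scaled_F (lam : ℝ) :
    Tendsto (fun L : ℕ => Real.exp lam * y lam ^ (L + 2) * F lam L) atTop (𝓝 1) := by
  have H := isParam lam
  obtain ⟨ρ, hρ, hs⟩ := exists_radius lam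
  have hρ0 : 0 < ρ := (y_pos lam).trans hρ
  have hcont : ContinuousOn (fun x => (Complex.exp lam)⁻¹ * Lam lam *
      cotRem (Lam lam * (y lam - x))) (Metric.closedBall 0 ρ) := by
    intro x hx
    have := (differentiableAt_cotRem (hs x (by simpa using hx))).comp x
      (by fun_prop : DifferentiableAt ℂ (fun x => Lam lam * (y lam - x)) x)
    exact (this.const_mul _).continuousAt.continuousWithinAt
  obtain ⟨C, hC⟩ := (isCompact_closedBall (0 : ℂ) ρ).exists_bound_of_continuousOn hcont
  have hb := H.norm_scaled_coef_sub_one_le hρ0 hs (fun x hx => hC x (by simp [hx]))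
  have hlim : Tendsto (fun n : ℕ => ‖Complex.exp lam‖ * ‖(y lam : ℂ)‖ * C *
      (‖(y lam : ℂ)‖ / ρ) ^ n) atTop (𝓝 0) := by
    have := tendsto_pow_atTop_nhds_zero_of_lt_one (div_nonneg (norm_nonneg _) hρ0.le)
      ((div_lt_one hρ0).2 ((norm_y lam).trans_lt hρ))
    simpa using this.const_mul (‖Complex.exp lam‖ * ‖(y lam : ℂ)‖ * C)
  have h1 := (squeeze_zero_norm hb hlim).comp (tendsto_add_atTop_nat 1)
  rw [tendsto_iff_norm_sub_tendsto_zero]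
  refine h1.norm.congr' ?_ |>.trans (by simp)
  refine Eventually.of_forall fun L => ?_
  simp only [Function.comp_apply]
  rw [← F_eq_coef, Nat.add_sub_cancel, ← Complex.norm_real]
  push_cast
  rfl

lemma log_F (lam : ℝ) (L : ℕ) : Real.log (F lam L)
    = Real.log (Real.exp lam * y lam ^ (L + 2) * F lam L) - lam - (L + 2) * Real.log (y lam) := by
  rw [Real.log_mul (mul_ne_zero (Real.exp_ne_zero _) (pow_ne_zero _ (y_pos lam).ne'))
    (F_pos lam L).ne', Real.log_mul (Real.exp_ne_zero _) (pow_ne_zero _ (y_pos lam).ne'),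
    Real.log_exp, Real.log_pow]
  push_cast
  ring

lemma tendsto_log_F_div (lam : ℝ) :
    Tendsto (fun L : ℕ => Real.log (F lam L) / L) atTop (𝓝 (U lam)) := by
  have h1 := ((Real.continuousAt_log one_ne_zero).tendsto.comp (tendsto_scaled_F lam))
  have h2 : Tendsto (fun L : ℕ => Real.log (Real.exp lam * y lam ^ (L + 2) * F lam L)
      - lam - 2 * Real.log (y lam)) atTop (𝓝 (Real.log 1 - lam - 2 * Real.log (y lam))) :=
    (h1.sub_const _).sub_const _
  have h3 := (h2.div_atTop tendsto_natCast_atTop_atTop).sub_const (Real.log (y lam))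
  rw [zero_sub] at h3
  refine h3.congr' ?_
  filter_upwards [eventually_gt_atTop 0] with L hL
  have hL' : (L : ℝ) ≠ 0 := by exact_mod_cast hL.ne'
  rw [log_F]
  field_simp
  ring

end RealParameter

/-! ### Complex λ near 0: holomorphic extension of y and uniform asymptotics -/

section ComplexParameter

open Complex

/-- The power series with `t * atanSeries (t ^ 2) = arctan t`. -/
noncomputable def atanSeries (s : ℂ) : ℂ := ∑' n : ℕ, (-s) ^ n / (2 * n + 1)

lemma arctan_eq {t : ℂ} (ht : ‖t‖ < 1) : arctan t = t * atanSeries (t ^ 2) := by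
  rw [← (hasSum_arctan ht).tsum_eq, atanSeries, ← tsum_mul_left]
  refine tsum_congr fun n => ?_
  rw [neg_pow (t ^ 2), ← pow_mul]
  push_cast
  ring

lemma atanSeries_zero : atanSeries 0 = 1 := by
  rw [atanSeries, tsum_eq_single 0]
  · simp
  · intro n hn
    simp [hn]

lemma differentiableOn_atanSeries : DifferentiableOn ℂ atanSeries (Metric.ball 0 (1 / 2)) := by
  refine Complex.differentiableOn_tsum_of_summable_norm (u := fun n : ℕ => (1 / 2 : ℝ) ^ n)
    summable_geometric_two (fun n => by fun_prop) Metric.isOpen_ball fun n w hw => ?_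
  rw [mem_ball_zero_iff] at hw
  have h1 : (1 : ℝ) ≤ ‖(2 * n + 1 : ℂ)‖ := by
    have : (2 * n + 1 : ℂ) = ((2 * n + 1 : ℕ) : ℂ) := by push_cast; rfl
    rw [this, Complex.norm_natCast]
    push_cast
    linarith [(Nat.cast_nonneg n : (0 : ℝ) ≤ n)]
  rw [norm_div, norm_pow, norm_neg]
  refine (div_le_self (by positivity) h1).trans ?_
  exact pow_le_pow_left₀ (norm_nonneg _) hw.le n

lemma differentiableAt_atanSeries {s : ℂ} (hs : ‖s‖ < 1 / 2) : DifferentiableAt ℂ atanSeries s :=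
  differentiableOn_atanSeries.differentiableAt
    (Metric.isOpen_ball.mem_nhds (by simpa using hs))

lemma norm_lt_one_of_sq {t s : ℂ} (h : t ^ 2 = s) (hs : ‖s‖ < 1) : ‖t‖ < 1 := by
  rw [← h, norm_pow] at hs
  exact (sq_lt_one_iff₀ (norm_nonneg _)).1 hs

/-- With s = t², the second factor is the derivative of t ↦ t A(t²) = arctan t, A being the series,
and arctan' = 1/(1 + t²). The proof differentiates tan(arctan t) = t. -/
lemma atanSeries_ode {s : ℂ} (hs : ‖s‖ < 1 / 2) :
    (1 + s) * (atanSeries s + 2 * s * deriv atanSeries s) = 1 := by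
  obtain ⟨t, rfl⟩ : ∃ t : ℂ, t ^ 2 = s := IsAlgClosed.exists_pow_nat_eq s two_pos
  have ht : ‖t‖ < 1 := norm_lt_one_of_sq rfl (by linarith)
  have hne : ∀ u : ℂ, ‖u‖ < 1 → Complex.tan (arctan u) = u := fun u hu =>
    tan_arctan (by rintro rfl; simp at hu) (by rintro rfl; simp at hu)
  have hc : Complex.cos (arctan t) ≠ 0 := by
    intro h
    have h1 := hne t ht
    -- If the cosine vanished, division by zero would give tan = 0, hence t = 0, where the cosine is
    -- 1.
    rw [Complex.tan_eq_sin_div_cos, h, div_zero] at h1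
    rw [← h1] at h
    simp [arctan] at h
  have h1 : HasDerivAt (fun u : ℂ => u ^ 2) (2 * t) t := by
    simpa using hasDerivAt_pow 2 t
  have h1' : HasDerivAt (fun u : ℂ => atanSeries (u ^ 2))
      (deriv atanSeries (t ^ 2) * (2 * t)) t :=
    HasDerivAt.comp (h₂ := atanSeries) t (differentiableAt_atanSeries hs).hasDerivAt h1
  have h2 : HasDerivAt (fun u : ℂ => u * atanSeries (u ^ 2)) _ t := (hasDerivAt_id t).mul h1'
  have he : (fun u : ℂ => u * atanSeries (u ^ 2)) =ᶠ[𝓝 t] arctan := by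
    have : ∀ᶠ u : ℂ in 𝓝 t, ‖u‖ < 1 := (isOpen_lt continuous_norm continuous_const).mem_nhds ht
    filter_upwards [this] with u hu using (arctan_eq hu).symm
  have h3 := (Complex.hasDerivAt_tan hc).comp t (h2.congr_of_eventuallyEq he.symm)
  have h4 : (Complex.tan ∘ arctan) =ᶠ[𝓝 t] id := by
    have : ∀ᶠ u : ℂ in 𝓝 t, ‖u‖ < 1 := (isOpen_lt continuous_norm continuous_const).mem_nhds ht
    filter_upwards [this] with u hu using hne u hu
  have h5 := h3.unique ((hasDerivAt_id t).congr_of_eventuallyEq h4)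
  have h6 := hne t ht
  rw [Complex.tan_eq_sin_div_cos, div_eq_iff hc] at h6
  have h7 := Complex.sin_sq_add_cos_sq (arctan t)
  rw [h6] at h7
  field_simp at h5
  simp only [id] at h5
  have h8 : atanSeries (t ^ 2) + 2 * t ^ 2 * deriv atanSeries (t ^ 2)
    = Complex.cos (arctan t) ^ 2 := by
    linear_combination h5
  rw [h8]
  linear_combination h7

/-- The holomorphic extension of `y` to a complex neighbourhood of `0`. -/
noncomputable def yC (lam : ℂ) : ℂ := Complex.exp (-lam) * atanSeries (Complex.exp (-lam) - 1)

lemma yC_zero : yC 0 = 1 := by simp [yC, atanSeries_zero]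

/-- Either square root t of e^(-λ) - 1 may be used, since arctan(t)/t is even; only `yC`, not Λ, has
to be holomorphic in λ. -/
lemma exists_isParam_yC {lam : ℂ} (h : ‖Complex.exp (-lam) - 1‖ < 1) :
    ∃ Λ, IsParam (Complex.exp lam) Λ (yC lam) := by
  obtain ⟨t, ht⟩ : ∃ t : ℂ, t ^ 2 = Complex.exp (-lam) - 1 :=
    IsAlgClosed.exists_pow_nat_eq _ two_pos
  have hz : Complex.exp lam * (1 + t ^ 2) = 1 := by
    rw [ht, add_sub_cancel, ← Complex.exp_add, add_neg_cancel, Complex.exp_zero]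
  rcases eq_or_ne t 0 with rfl | ht0
  · rw [zero_pow two_ne_zero, add_zero, mul_one] at hz
    refine ⟨0, ?_⟩
    have : yC lam = 1 := by
      rw [yC, ← ht, zero_pow two_ne_zero, atanSeries_zero, Complex.exp_neg, hz]
      simp
    rw [this, hz]
    constructor <;> simp [sincC_zero, wcot_zero]
  · refine ⟨Complex.exp lam * t, ?_⟩
    have : yC lam = arctan t / (Complex.exp lam * t) := by
      rw [arctan_eq (norm_lt_one_of_sq ht h), yC, ht, Complex.exp_neg]
      field_simp
    rw [this]
    exact isParam_arctan hz ht0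

lemma y_eq_yC {lam : ℝ} (h : ‖Complex.exp (-(lam : ℂ)) - 1‖ < 1) : (y lam : ℂ) = yC lam := by
  rcases eq_or_ne lam 0 with rfl | h0
  · rw [y_zero, Complex.ofReal_zero, yC_zero, Complex.ofReal_one]
  · have ht := arg_sq lam
    have := arg_ne_zero h0
    rw [y_eq h0, ← exp_mul_arg, arctan_eq (norm_lt_one_of_sq ht h), yC, ht, Complex.exp_neg]
    field_simp

lemma differentiableAt_yC {lam : ℂ} (h : ‖Complex.exp (-lam) - 1‖ < 1 / 2) :
    DifferentiableAt ℂ yC lam := by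
  have h1 := (differentiableAt_atanSeries h).comp lam
    (by fun_prop : DifferentiableAt ℂ (fun l => Complex.exp (-l) - 1) lam)
  exact DifferentiableAt.mul (by fun_prop) h1

lemma yC_ode {lam : ℂ} (h : ‖Complex.exp (-lam) - 1‖ < 1 / 2) :
    (2 * Complex.exp lam - 1) * yC lam + 2 * (Complex.exp lam - 1) * deriv yC lam = 1 := by
  have h0 : HasDerivAt (fun l : ℂ => Complex.exp (-l)) (-Complex.exp (-lam)) lam := by
    simpa using (hasDerivAt_neg lam).cexp
  have h0' : HasDerivAt (fun l : ℂ => atanSeries (Complex.exp (-l) - 1))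
      (deriv atanSeries (Complex.exp (-lam) - 1) * -Complex.exp (-lam)) lam :=
    HasDerivAt.comp (h₂ := atanSeries) lam (differentiableAt_atanSeries h).hasDerivAt
      (h0.sub_const 1)
  have h1 : HasDerivAt yC _ lam := h0.mul h0'
  rw [h1.deriv, yC]
  have h2 := atanSeries_ode h
  have h3 : Complex.exp lam * Complex.exp (-lam) = 1 := by
    rw [← Complex.exp_add, add_neg_cancel, Complex.exp_zero]
  set e := Complex.exp lam
  set f := Complex.exp (-lam)
  set a := atanSeries (f - 1)
  set b := deriv atanSeries (f - 1)
  linear_combination h2 + (-2 * f * b) * h3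

lemma differentiable_coef (n : ℕ) : Differentiable ℂ fun z => coef z n := by
  induction n using Nat.strong_induction_on with
  | _ n ih =>
    rcases n with _ | n
    · simp only [coef_zero]
      fun_prop
    · simp only [coef_succ]
      refine Differentiable.div_const (Differentiable.add (differentiable_id.mul ?_) ?_) _
      · refine Differentiable.fun_sum fun k hk => ?_
        rw [Finset.mem_range] at hk
        exact (ih k hk).mul (ih (n - k) (by omega))
      · split_ifs <;> fun_prop

/-- The ratio of `⟨e^{λN}⟩` to its leading asymptotics, for complex `λ`. -/
noncomputable def ratio (L : ℕ) (lam : ℂ) : ℂ :=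
  Complex.exp lam * yC lam ^ (L + 2) * coef (Complex.exp lam) (L + 1)

lemma continuousAt_yC_zero : ContinuousAt yC 0 :=
  (differentiableAt_yC (by simp)).continuousAt

/-- A disc around `0` on which the asymptotics of `⟨e^{λN}⟩` is uniform. -/
lemma exists_disc : ∃ r : ℝ, 0 < r ∧ r ≤ 1 ∧ ∀ lam : ℂ, ‖lam‖ < r →
    ‖Complex.exp (-lam) - 1‖ < 1 / 2 ∧ ‖Complex.exp lam‖ < 2 ∧ ‖(Complex.exp lam)⁻¹‖ < 2 ∧
    ‖Complex.exp lam * (1 - Complex.exp lam)‖ < 1 / 16 ∧ ‖yC lam - 1‖ < 1 / 4 ∧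
    ‖Complex.log (yC lam)‖ < 1 := by
  have key : ∀ {f : ℂ → ℂ} {c : ℝ}, ContinuousAt f 0 → ‖f 0‖ < c → ∀ᶠ l in 𝓝 (0 : ℂ), ‖f l‖ < c :=
    fun hf h0 => hf.norm.eventually_lt continuousAt_const h0
  have hlog : ContinuousAt (fun l => Complex.log (yC l)) 0 :=
    continuousAt_yC_zero.clog (by rw [yC_zero]; exact Complex.one_mem_slitPlane)
  have h := (((((key (f := fun l => Complex.exp (-l) - 1) (c := 1 / 2) (by fun_prop)
    (by simp)).and
    (key (f := Complex.exp) (c := 2) (by fun_prop) (by simp))).and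
    (key (f := fun l => (Complex.exp l)⁻¹) (c := 2)
      (ContinuousAt.inv₀ (by fun_prop) (Complex.exp_ne_zero _)) (by simp))).and
    (key (f := fun l => Complex.exp l * (1 - Complex.exp l)) (c := 1 / 16) (by fun_prop)
      (by simp))).and
    (key (f := fun l => yC l - 1) (c := 1 / 4) (continuousAt_yC_zero.sub continuousAt_const)
      (by simp [yC_zero]))).and
    (key (f := fun l => Complex.log (yC l)) (c := 1) hlog (by simp [yC_zero]))
  obtain ⟨r, hr, hb⟩ := Metric.eventually_nhds_iff_ball.1 h
  refine ⟨min r 1, lt_min hr one_pos, min_le_right _ _, fun lam hl => ?_⟩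
  obtain ⟨⟨⟨⟨⟨a, b⟩, c⟩, d⟩, e⟩, f⟩ := hb lam (by simpa using hl.trans_le (min_le_left _ _))
  exact ⟨a, b, c, d, e, f⟩

/-- A disc as in `exists_disc`. -/
noncomputable def discRadius : ℝ := exists_disc.choose

lemma discRadius_pos : 0 < discRadius := exists_disc.choose_spec.1

lemma discRadius_le : discRadius ≤ 1 := exists_disc.choose_spec.2.1

lemma disc_spec {lam : ℂ} (h : ‖lam‖ < discRadius) :
    ‖Complex.exp (-lam) - 1‖ < 1 / 2 ∧ ‖Complex.exp lam‖ < 2 ∧ ‖(Complex.exp lam)⁻¹‖ < 2 ∧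
    ‖Complex.exp lam * (1 - Complex.exp lam)‖ < 1 / 16 ∧ ‖yC lam - 1‖ < 1 / 4 ∧
    ‖Complex.log (yC lam)‖ < 1 := exists_disc.choose_spec.2.2 lam h

lemma yC_mem_slitPlane {lam : ℂ} (h : ‖lam‖ < discRadius) : yC lam ∈ Complex.slitPlane := by
  obtain ⟨-, -, -, -, h5, -⟩ := disc_spec h
  simpa using Complex.mem_slitPlane_of_norm_lt_one (z := yC lam - 1) (by linarith)

/-- The Cauchy estimate on the fixed circle |x| = 2. All arguments of `cotRem` stay in the unit
disc, so one bound serves every λ in the disc. -/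
lemma exists_norm_ratio_sub_one_le : ∃ C : ℝ, ∀ L : ℕ, ∀ lam : ℂ, ‖lam‖ < discRadius →
    ‖ratio L lam - 1‖ ≤ C * (5 / 8 : ℝ) ^ L := by
  have hcont : ContinuousOn cotRem (Metric.closedBall 0 1) := fun w hw =>
    (differentiableAt_cotRem (sincC_ne_zero_of_norm_le
      (by simpa using hw))).continuousAt.continuousWithinAt
  obtain ⟨B, hB⟩ := (isCompact_closedBall (0 : ℂ) 1).exists_bound_of_continuousOn hcont
  have hB0 : 0 ≤ B := (norm_nonneg _).trans (hB 0 (by simp))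
  refine ⟨2 * 2 * (2 * 1 * B), fun L lam hl => ?_⟩
  obtain ⟨h1, h2, h3, h4, h5, -⟩ := disc_spec hl
  obtain ⟨Λ, H⟩ := exists_isParam_yC (h1.trans (by norm_num))
  have hΛ : ‖Λ‖ < 1 / 4 := by
    rw [← H.sq, norm_pow] at h4
    exact lt_of_pow_lt_pow_left₀ 2 (by norm_num) (h4.trans_le (by norm_num))
  have hY : ‖yC lam‖ < 5 / 4 := by
    have := norm_add_le (yC lam - 1) 1
    rw [sub_add_cancel, norm_one] at this
    linarith
  -- The constants of the disc serve this: |Λ| < 1/4 and |y - x| ≤ 4 keep the argument in the unit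
  -- disc, away from the zeros ±π, ±2π, … of `sincC`.
  have hw : ∀ x : ℂ, ‖x‖ ≤ 2 → ‖Λ * (yC lam - x)‖ ≤ 1 := by
    intro x hx
    rw [norm_mul]
    have h6 : ‖yC lam - x‖ ≤ 4 := (norm_sub_le _ _).trans (by linarith)
    nlinarith [norm_nonneg Λ, norm_nonneg (yC lam - x)]
  have hC : ∀ x : ℂ, ‖x‖ = 2 →
      ‖(Complex.exp lam)⁻¹ * Λ * cotRem (Λ * (yC lam - x))‖ ≤ 2 * 1 * B := by
    intro x hx
    rw [norm_mul, norm_mul]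
    gcongr
    · linarith
    · exact hB _ (by simpa using hw x hx.le)
  have hb := H.norm_scaled_coef_sub_one_le two_pos (fun x hx => sincC_ne_zero_of_norm_le (hw x hx))
    hC (L + 1)
  refine hb.trans ?_
  -- The rate 5/8 is the bound 5/4 on |y| divided by the radius 2.
  have h7 : (‖yC lam‖ / 2) ^ (L + 1) ≤ (5 / 8 : ℝ) ^ L := by
    calc (‖yC lam‖ / 2) ^ (L + 1) ≤ (5 / 8 : ℝ) ^ (L + 1) :=
          pow_le_pow_left₀ (by positivity) (by linarith) _
      _ ≤ (5 / 8 : ℝ) ^ L := pow_le_pow_of_le_one (by norm_num) (by norm_num) (Nat.le_succ L)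
  have h8 : ‖Complex.exp lam‖ * ‖yC lam‖ ≤ 2 * 2 :=
    mul_le_mul h2.le (by linarith) (norm_nonneg _) (by norm_num)
  exact mul_le_mul (mul_le_mul_of_nonneg_right h8 (by positivity)) h7 (by positivity)
    (by positivity)

end ComplexParameter

/-! ### Cumulants: convergence of derivatives, the values at 0 and the Mandel parameter -/

section Cumulants

open Complex

/-- Lets real Taylor coefficients be computed from a holomorphic extension; the induction replaces
both functions by their derivatives. -/
lemma ofReal_iteratedDeriv {g : ℂ → ℂ} {h : ℝ → ℝ} {r : ℝ}
    (hg : DifferentiableOn ℂ g (Metric.ball 0 r)) (e : ∀ t : ℝ, |t| < r → (h t : ℂ) = g t)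
    (n : ℕ) {t : ℝ} (ht : |t| < r) : ((iteratedDeriv n h t : ℝ) : ℂ) = iteratedDeriv n g t := by
  induction n generalizing g h with
  | zero => simpa using e t ht
  | succ n ih =>
    rw [iteratedDeriv_succ', iteratedDeriv_succ']
    refine ih (hg.deriv Metric.isOpen_ball) fun s hs => ?_
    have hd : HasDerivAt g (deriv g s) s :=
      (hg.differentiableAt (Metric.isOpen_ball.mem_nhds (by simpa using hs))).hasDerivAt
    have hO : ∀ᶠ u : ℝ in 𝓝 s, |u| < r := (isOpen_lt continuous_abs continuous_const).mem_nhds hs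
    have h1 : HasDerivAt (fun u : ℝ => (h u : ℂ)) (deriv g s) s :=
      hd.comp_ofReal.congr_of_eventuallyEq (hO.mono e)
    have h2 : HasDerivAt h (deriv g s).re s := by
      simpa [Function.comp_def] using Complex.reCLM.hasFDerivAt.comp_hasDerivAt s h1
    rw [h2.deriv]
    exact h2.ofReal_comp.unique h1

/-- Weierstrass' theorem, iterated: locally uniform limits of holomorphic functions commute with
differentiation. -/
lemma tendsto_iteratedDeriv {G : ℕ → ℂ → ℂ} {g : ℂ → ℂ} {V : Set ℂ} (hV : IsOpen V)
    (h : TendstoLocallyUniformlyOn G g atTop V) (hG : ∀ᶠ L in atTop, DifferentiableOn ℂ (G L) V)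
    (n : ℕ) {x : ℂ} (hx : x ∈ V) :
    Tendsto (fun L => iteratedDeriv n (G L) x) atTop (𝓝 (iteratedDeriv n g x)) := by
  induction n generalizing G g with
  | zero => simpa using h.tendsto_at hx
  | succ n ih =>
    simp only [iteratedDeriv_succ']
    exact ih (h.deriv hG hV) (hG.mono fun L hL => hL.deriv hV)

/-- The holomorphic extension of `U` to a complex neighbourhood of `0`. -/
noncomputable def UC (lam : ℂ) : ℂ := -Complex.log (yC lam)

lemma differentiableAt_yC_of_norm_lt {lam : ℂ} (h : ‖lam‖ < discRadius) :
    DifferentiableAt ℂ yC lam := differentiableAt_yC (disc_spec h).1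

lemma differentiableOn_UC : DifferentiableOn ℂ UC (Metric.ball 0 discRadius) := by
  intro lam h
  rw [mem_ball_zero_iff] at h
  exact ((differentiableAt_yC_of_norm_lt h).clog
    (yC_mem_slitPlane h)).neg.differentiableWithinAt

lemma y_eq_yC_of_abs_lt {t : ℝ} (h : |t| < discRadius) : (y t : ℂ) = yC t := by
  refine y_eq_yC ((disc_spec (lam := t) ?_).1.trans (by norm_num))
  rwa [Complex.norm_real]

lemma U_eq_UC {t : ℝ} (h : |t| < discRadius) : (U t : ℂ) = UC t := by
  rw [U, UC, ← y_eq_yC_of_abs_lt h, Complex.ofReal_neg, Complex.ofReal_log (y_pos t).le]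

lemma eventually_abs_lt_discRadius : ∀ᶠ t : ℝ in 𝓝 0, |t| < discRadius :=
  (isOpen_lt continuous_abs continuous_const).mem_nhds (by simpa using discRadius_pos)

lemma analyticAt_U : AnalyticAt ℝ U 0 := by
  have h1 : AnalyticAt ℂ UC ((0 : ℝ) : ℂ) := differentiableOn_UC.analyticAt
    (Metric.isOpen_ball.mem_nhds (by simpa using discRadius_pos))
  refine h1.re_ofReal.congr ?_
  filter_upwards [eventually_abs_lt_discRadius] with t ht
  rw [← U_eq_UC ht, Complex.ofReal_re]

lemma tendsto_y : Tendsto y (𝓝 0) (𝓝 1) := by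
  have h1 : ContinuousAt (fun t : ℝ => (yC t).re) 0 := by
    have h2 : ContinuousAt yC ((0 : ℝ) : ℂ) := by simpa using continuousAt_yC_zero
    exact Complex.continuous_re.continuousAt.comp
      (h2.comp (f := fun t : ℝ => (t : ℂ)) Complex.continuous_ofReal.continuousAt)
  have h3 : Tendsto (fun t : ℝ => (yC t).re) (𝓝 0) (𝓝 1) := by
    simpa [ContinuousAt, yC_zero] using h1
  refine h3.congr' ?_
  filter_upwards [eventually_abs_lt_discRadius] with t ht
  rw [← y_eq_yC_of_abs_lt ht, Complex.ofReal_re]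

/-- The holomorphic extension of `L⁻¹ ln ⟨e^{λN}⟩` to a complex neighbourhood of `0`. -/
noncomputable def cgfC (L : ℕ) (lam : ℂ) : ℂ :=
  (L : ℂ)⁻¹ * (Complex.log (ratio L lam) - lam - (L + 2) * Complex.log (yC lam))

lemma eventually_norm_ratio_sub_one_le :
    ∀ᶠ L : ℕ in atTop, ∀ lam : ℂ, ‖lam‖ < discRadius → ‖ratio L lam - 1‖ ≤ 1 / 2 := by
  obtain ⟨C, hC⟩ := exists_norm_ratio_sub_one_le
  have hlim : Tendsto (fun L : ℕ => C * (5 / 8 : ℝ) ^ L) atTop (𝓝 0) := by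
    simpa using (tendsto_pow_atTop_nhds_zero_of_lt_one (r := (5 / 8 : ℝ)) (by norm_num)
      (by norm_num)).const_mul C
  filter_upwards [hlim.eventually_le_const (by norm_num : (0 : ℝ) < 1 / 2)] with L hL lam hl
  exact (hC L lam hl).trans hL

lemma eventually_differentiableOn_cgfC :
    ∀ᶠ L : ℕ in atTop, DifferentiableOn ℂ (cgfC L) (Metric.ball 0 discRadius) := by
  filter_upwards [eventually_norm_ratio_sub_one_le] with L hL lam hl
  rw [mem_ball_zero_iff] at hl
  have h1 : ratio L lam ∈ Complex.slitPlane := by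
    simpa using Complex.mem_slitPlane_of_norm_lt_one (z := ratio L lam - 1)
      ((hL lam hl).trans_lt (by norm_num))
  have hy := differentiableAt_yC_of_norm_lt hl
  have hr : DifferentiableAt ℂ (ratio L) lam := by
    have h2 : DifferentiableAt ℂ (fun l => coef (Complex.exp l) (L + 1)) lam :=
      (differentiable_coef (L + 1) _).comp lam Complex.differentiable_exp.differentiableAt
    exact (Complex.differentiable_exp.differentiableAt.mul (hy.pow (L + 2))).mul h2
  have h3 := hr.clog h1
  have h4 := hy.clog (yC_mem_slitPlane hl)
  exact (((h3.sub differentiableAt_id).sub (h4.const_mul _)).const_mul _).differentiableWithinAt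

lemma tendstoUniformlyOn_cgfC :
    TendstoUniformlyOn cgfC UC atTop (Metric.ball 0 discRadius) := by
  rw [Metric.tendstoUniformlyOn_iff]
  intro ε hε
  -- The numerator 4 dominates |log ratio| ≤ 3/4, |λ| < 1 and 2|log y| < 2.
  have hlim : Tendsto (fun L : ℕ => (4 : ℝ) / L) atTop (𝓝 0) :=
    tendsto_const_nhds.div_atTop tendsto_natCast_atTop_atTop
  filter_upwards [eventually_norm_ratio_sub_one_le, hlim.eventually_lt_const hε,
    eventually_gt_atTop 0] with L hL hLε hL0 lam hl
  rw [mem_ball_zero_iff] at hl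
  have hL' : (L : ℂ) ≠ 0 := by exact_mod_cast hL0.ne'
  rw [dist_comm, dist_eq_norm]
  have e : cgfC L lam - UC lam
      = (L : ℂ)⁻¹ * (Complex.log (ratio L lam) - lam - 2 * Complex.log (yC lam)) := by
    rw [cgfC, UC]
    field_simp
    ring
  rw [e, norm_mul, norm_inv, Complex.norm_natCast]
  refine lt_of_le_of_lt ?_ hLε
  rw [div_eq_inv_mul]
  refine mul_le_mul_of_nonneg_left ?_ (by positivity)
  have h1 := hL lam hl
  have h2 := Complex.norm_log_one_add_half_le_self h1
  rw [add_sub_cancel] at h2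
  have h3 := (disc_spec hl).2.2.2.2.2
  have h4 := hl.trans_le discRadius_le
  have h5 : ‖2 * Complex.log (yC lam)‖ = 2 * ‖Complex.log (yC lam)‖ := by simp
  calc _ ≤ ‖Complex.log (ratio L lam)‖ + ‖lam‖ + ‖2 * Complex.log (yC lam)‖ :=
        (norm_sub_le _ _).trans (add_le_add_left (norm_sub_le _ _) _)
    _ ≤ 4 := by linarith

lemma cgf_eq_cgfC (L : ℕ) {t : ℝ} (ht : |t| < discRadius) :
    (((L : ℝ)⁻¹ * cgf count (countLaw L) t : ℝ) : ℂ) = cgfC L t := by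
  have hr : ratio L t = ((Real.exp t * y t ^ (L + 2) * F t L : ℝ) : ℂ) := by
    rw [ratio, ← y_eq_yC_of_abs_lt ht, ← F_eq_coef, Nat.add_sub_cancel]
    push_cast
    rfl
  have hp : 0 ≤ Real.exp t * y t ^ (L + 2) * F t L :=
    (mul_pos (mul_pos (Real.exp_pos t) (pow_pos (y_pos t) _)) (F_pos t L)).le
  have hF : cgf count (countLaw L) t = Real.log (F t L) := rfl
  rw [hF, cgfC, hr, ← y_eq_yC_of_abs_lt ht, log_F, ← Complex.ofReal_log hp,
    ← Complex.ofReal_log (y_pos t).le]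
  push_cast
  rfl

lemma tendsto_cumulant (n : ℕ) :
    Tendsto (fun L : ℕ => cumulant n count (countLaw L) / L) atTop (𝓝 (iteratedDeriv n U 0)) := by
  have h0 : |(0 : ℝ)| < discRadius := by simpa using discRadius_pos
  have h1 := tendsto_iteratedDeriv Metric.isOpen_ball
    tendstoUniformlyOn_cgfC.tendstoLocallyUniformlyOn eventually_differentiableOn_cgfC n
    (x := ((0 : ℝ) : ℂ)) (by simpa using discRadius_pos)
  rw [← ofReal_iteratedDeriv differentiableOn_UC (fun t ht => U_eq_UC ht) n h0] at h1
  have h2 := (Complex.continuous_re.tendsto _).comp h1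
  rw [Complex.ofReal_re] at h2
  refine h2.congr' ?_
  filter_upwards [eventually_differentiableOn_cgfC] with L hL
  rw [Function.comp_apply, ← ofReal_iteratedDeriv hL (fun t ht => cgf_eq_cgfC L ht) n h0,
    Complex.ofReal_re, iteratedDeriv_const_mul_field, cumulant]
  ring

lemma UC_zero : UC 0 = 0 := by simp [UC, yC_zero]

/-- Divide `yC_ode` by y and use e^U = 1/y and U' = -y'/y. -/
lemma UC_ode {lam : ℂ} (h : ‖lam‖ < discRadius) :
    Complex.exp (UC lam)
      = 2 * Complex.exp lam - 1 - 2 * (Complex.exp lam - 1) * deriv UC lam := by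
  have hs := yC_mem_slitPlane h
  have hy0 : yC lam ≠ 0 := Complex.slitPlane_ne_zero hs
  have h1 : HasDerivAt UC (-(deriv yC lam / yC lam)) lam :=
    ((differentiableAt_yC_of_norm_lt h).hasDerivAt.clog hs).neg
  rw [h1.deriv, UC, Complex.exp_neg, Complex.exp_log hy0]
  field_simp
  linear_combination -yC_ode (disc_spec h).1

lemma eq_deriv_of_eqOn_ball {f g : ℂ → ℂ} {f' g' : ℂ → ℂ} {r : ℝ}
    (h : ∀ x, ‖x‖ < r → f x = g x) (hf : ∀ x, ‖x‖ < r → HasDerivAt f (f' x) x)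
    (hg : ∀ x, ‖x‖ < r → HasDerivAt g (g' x) x) (x : ℂ) (hx : ‖x‖ < r) : f' x = g' x := by
  have hO : ∀ᶠ u : ℂ in 𝓝 x, ‖u‖ < r := (isOpen_lt continuous_norm continuous_const).mem_nhds hx
  exact (hf x hx).unique ((hg x hx).congr_of_eventuallyEq (hO.mono h))

/-- The first Taylor coefficients of a solution of `e^f = 2 e^x - 1 - 2 (e^x - 1) f'`. -/
lemma taylor_of_ode {f : ℂ → ℂ} {r : ℝ} (hr : 0 < r)
    (hf : DifferentiableOn ℂ f (Metric.ball 0 r)) (hf0 : f 0 = 0)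
    (ode : ∀ x, ‖x‖ < r →
      Complex.exp (f x) = 2 * Complex.exp x - 1 - 2 * (Complex.exp x - 1) * deriv f x) :
    iteratedDeriv 1 f 0 = 2 / 3 ∧ iteratedDeriv 2 f 0 = 2 / 45 ∧
      iteratedDeriv 3 f 0 = 2 / 945 ∧ iteratedDeriv 4 f 0 = -22 / 4725 := by
  have hd : ∀ n x, ‖x‖ < r → HasDerivAt (iteratedDeriv n f) (iteratedDeriv (n + 1) f x) x := by
    intro n x hx
    have ha : AnalyticAt ℂ f x :=
      hf.analyticAt (Metric.isOpen_ball.mem_nhds (by simpa using hx))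
    rw [iteratedDeriv_succ]
    rw [iteratedDeriv_eq_iterate]
    exact (ha.iterated_deriv n).differentiableAt.hasDerivAt
  have d0 : ∀ x, ‖x‖ < r → HasDerivAt f (iteratedDeriv 1 f x) x := by
    simpa using hd 0
  have d1 := hd 1
  have d2 := hd 2
  have d3 := hd 3
  have d4 := hd 4
  norm_num only at d1 d2 d3 d4
  have hE : ∀ x, ‖x‖ < r → HasDerivAt (fun x => Complex.exp (f x))
      (Complex.exp (f x) * iteratedDeriv 1 f x) x := fun x hx => (d0 x hx).cexp
  have he : ∀ x, HasDerivAt Complex.exp (Complex.exp x) x := Complex.hasDerivAt_exp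
  set f1 := iteratedDeriv 1 f with hf1
  set f2 := iteratedDeriv 2 f
  set f3 := iteratedDeriv 3 f
  set f4 := iteratedDeriv 4 f
  set f5 := iteratedDeriv 5 f
  have E0 : ∀ x, ‖x‖ < r → Complex.exp (f x)
      = 2 * Complex.exp x - 1 - 2 * (Complex.exp x - 1) * f1 x := by
    intro x hx
    rw [ode x hx, hf1, iteratedDeriv_one]
  have E1 : ∀ x, ‖x‖ < r → Complex.exp (f x) * f1 x
      = 2 * Complex.exp x - 2 * Complex.exp x * f1 x - 2 * (Complex.exp x - 1) * f2 x := by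
    refine eq_deriv_of_eqOn_ball E0 hE fun x hx => ?_
    refine ((((he x).const_mul 2).sub_const 1).sub
      ((((he x).sub_const 1).const_mul 2).mul (d1 x hx))).congr_deriv ?_
    ring
  have E2 : ∀ x, ‖x‖ < r → Complex.exp (f x) * (f2 x + f1 x ^ 2)
      = 2 * Complex.exp x - 2 * Complex.exp x * f1 x - 4 * Complex.exp x * f2 x
        - 2 * (Complex.exp x - 1) * f3 x := by
    refine eq_deriv_of_eqOn_ball E1 (fun x hx => ?_) fun x hx => ?_
    · refine ((hE x hx).mul (d1 x hx)).congr_deriv ?_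
      ring
    · refine ((((he x).const_mul 2).sub (((he x).const_mul 2).mul (d1 x hx))).sub
        ((((he x).sub_const 1).const_mul 2).mul (d2 x hx))).congr_deriv ?_
      ring
  have E3 : ∀ x, ‖x‖ < r → Complex.exp (f x) * (f3 x + 3 * f1 x * f2 x + f1 x ^ 3)
      = 2 * Complex.exp x - 2 * Complex.exp x * f1 x - 6 * Complex.exp x * f2 x
        - 6 * Complex.exp x * f3 x - 2 * (Complex.exp x - 1) * f4 x := by
    refine eq_deriv_of_eqOn_ball E2 (fun x hx => ?_) fun x hx => ?_
    · refine ((hE x hx).mul ((d2 x hx).add ((d1 x hx).fun_pow 2))).congr_deriv ?_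
      simp only [Pi.add_apply]
      ring
    · refine (((((he x).const_mul 2).sub (((he x).const_mul 2).mul (d1 x hx))).sub
        (((he x).const_mul 4).mul (d2 x hx))).sub
        ((((he x).sub_const 1).const_mul 2).mul (d3 x hx))).congr_deriv ?_
      ring
  have E4 : ∀ x, ‖x‖ < r → Complex.exp (f x) * (f4 x + 3 * f2 x ^ 2 + 4 * f1 x * f3 x
        + 6 * f1 x ^ 2 * f2 x + f1 x ^ 4)
      = 2 * Complex.exp x - 2 * Complex.exp x * f1 x - 8 * Complex.exp x * f2 x
        - 12 * Complex.exp x * f3 x - 8 * Complex.exp x * f4 x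
        - 2 * (Complex.exp x - 1) * f5 x := by
    refine eq_deriv_of_eqOn_ball E3 (fun x hx => ?_) fun x hx => ?_
    · refine ((hE x hx).mul (((d3 x hx).add (((d1 x hx).const_mul 3).mul (d2 x hx))).add
        ((d1 x hx).fun_pow 3))).congr_deriv ?_
      simp only [Pi.add_apply, Pi.mul_apply]
      ring
    · refine ((((((he x).const_mul 2).sub (((he x).const_mul 2).mul (d1 x hx))).sub
        (((he x).const_mul 6).mul (d2 x hx))).sub (((he x).const_mul 6).mul (d3 x hx))).sub
        ((((he x).sub_const 1).const_mul 2).mul (d4 x hx))).congr_deriv ?_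
      ring
  -- At x = 0 the factor e^x - 1 removes the highest derivative, so the n-th differentiated equation
  -- is linear in the n-th derivative of f, with coefficient 2n + 1.
  have z0 : ‖(0 : ℂ)‖ < r := by simpa using hr
  have e1 := E1 0 z0
  have e2 := E2 0 z0
  have e3 := E3 0 z0
  have e4 := E4 0 z0
  rw [hf0, Complex.exp_zero] at e1 e2 e3 e4
  have v1 : f1 0 = 2 / 3 := by linear_combination (1 / 3) * e1
  rw [v1] at e2 e3 e4
  have v2 : f2 0 = 2 / 45 := by linear_combination (1 / 5) * e2
  rw [v2] at e3 e4
  have v3 : f3 0 = 2 / 945 := by linear_combination (1 / 7) * e3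
  rw [v3] at e4
  exact ⟨v1, v2, v3, by linear_combination (1 / 9) * e4⟩

lemma iteratedDeriv_U :
    iteratedDeriv 1 U 0 = 2 / 3 ∧ iteratedDeriv 2 U 0 = 2 / 45 ∧
      iteratedDeriv 3 U 0 = 2 / 945 ∧ iteratedDeriv 4 U 0 = -22 / 4725 := by
  have h0 : |(0 : ℝ)| < discRadius := by simpa using discRadius_pos
  have h := fun n => ofReal_iteratedDeriv (h := U) differentiableOn_UC (fun t ht => U_eq_UC ht) n h0
  obtain ⟨h1, h2, h3, h4⟩ := taylor_of_ode discRadius_pos differentiableOn_UC UC_zero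
    fun x hx => UC_ode hx
  rw [← Complex.ofReal_zero, ← h] at h1 h2 h3 h4
  exact ⟨Complex.ofReal_injective (h1.trans (by norm_num)),
    Complex.ofReal_injective (h2.trans (by norm_num)),
    Complex.ofReal_injective (h3.trans (by norm_num)),
    Complex.ofReal_injective (h4.trans (by norm_num))⟩

lemma integrableExpSet_count (L : ℕ) : integrableExpSet count (countLaw L) = Set.univ :=
  Set.eq_univ_of_forall fun t => integrable_exp_count L t

lemma cumulant_one (L : ℕ) : cumulant 1 count (countLaw L) = ∫ n, count n ∂(countLaw L) := by
  rw [cumulant, iteratedDeriv_one, deriv_cgf_zero (by simp [integrableExpSet_count])]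
  simp

lemma cumulant_two (L : ℕ) : cumulant 2 count (countLaw L) = Var[count; countLaw L] := by
  have h : (0 : ℝ) ∈ interior (integrableExpSet count (countLaw L)) := by
    simp [integrableExpSet_count]
  rw [cumulant, iteratedDeriv_two_cgf_eq_integral h, deriv_cgf_zero h,
    variance_eq_integral (measurable_of_countable _).aemeasurable]
  simp

/-- The limit is taken in the cotangent form, which is regular at Λ = 0. Only Λ → 0 is needed, and
it follows from Λ² → 0 without discussing branches. -/
lemma tendsto_closedForm {x : ℂ} (hx : ‖x‖ < 1) :
    Tendsto (fun lam : ℝ => closedForm lam x) (𝓝[≠] 0) (𝓝 (x / (1 - x))) := by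
  have hx1 : x ≠ 1 := by
    rintro rfl
    simp at hx
  have hexp : Tendsto (fun lam : ℝ => Complex.exp lam) (𝓝 0) (𝓝 1) := by
    have : Continuous fun lam : ℝ => Complex.exp lam := by fun_prop
    simpa using this.tendsto 0
  have hΛ : Tendsto Lam (𝓝 0) (𝓝 0) := by
    have h1 : Tendsto (fun lam : ℝ => Lam lam ^ 2) (𝓝 0) (𝓝 0) := by
      have h2 : Tendsto (fun lam : ℝ => Complex.exp lam * (1 - Complex.exp lam)) (𝓝 0)
          (𝓝 (1 * (1 - 1))) := hexp.mul (hexp.const_sub 1)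
      rw [sub_self, mul_zero] at h2
      exact h2.congr fun lam => ((isParam lam).sq).symm
    have h3 := h1.norm.sqrt
    rw [tendsto_zero_iff_norm_tendsto_zero]
    simpa [Real.sqrt_sq] using h3
  have hy : Tendsto (fun lam : ℝ => (y lam : ℂ)) (𝓝 0) (𝓝 1) := by
    have h1 := (Complex.continuous_ofReal.tendsto 1).comp tendsto_y
    rwa [Complex.ofReal_one] at h1
  have hv : Tendsto (fun lam : ℝ => (y lam : ℂ) - x) (𝓝 0) (𝓝 (1 - x)) := hy.sub_const x
  have hw : Tendsto (fun lam : ℝ => Lam lam * (y lam - x)) (𝓝 0) (𝓝 0) := by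
    simpa using hΛ.mul hv
  have hJ : Tendsto (fun lam : ℝ => wcot (Lam lam * (y lam - x))) (𝓝 0) (𝓝 1) := by
    have h1 : ContinuousAt wcot 0 :=
      (differentiableAt_wcot (by simp [sincC_zero])).continuousAt
    rw [ContinuousAt, wcot_zero] at h1
    exact h1.comp hw
  have hR : Tendsto (fun lam : ℝ => ricc (Complex.exp lam) (Lam lam) (y lam) x - 1) (𝓝 0)
      (𝓝 (x / (1 - x))) := by
    have h1 : 1 - x ≠ 0 := sub_ne_zero.2 hx1.symm
    have h2 := (hJ.div (hexp.mul hv) (by simpa using h1)).sub_const 1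
    rw [← ricc_one_zero x hx1, ricc, zero_mul, wcot_zero]
    exact h2
  refine (hR.mono_left nhdsWithin_le_nhds).congr' ?_
  have hne : ∀ᶠ lam : ℝ in 𝓝 0, x ≠ y lam :=
    (hy.eventually_ne hx1.symm).mono fun _ h => h.symm
  have hc : ∀ᶠ lam : ℝ in 𝓝 0, Complex.cos (Lam lam * x) ≠ 0 := by
    have h1 : Tendsto (fun lam : ℝ => Complex.cos (Lam lam * x)) (𝓝 0)
        (𝓝 (Complex.cos (0 * x))) :=
      (Complex.continuous_cos.tendsto _).comp (hΛ.mul_const x)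
    exact h1.eventually_ne (by simp)
  have hs : ∀ᶠ lam : ℝ in 𝓝 0, sincC (Lam lam * (y lam - x)) ≠ 0 := by
    have h1 : Tendsto (fun lam : ℝ => sincC (Lam lam * (y lam - x))) (𝓝 0) (𝓝 (sincC 0)) :=
      (differentiable_sincC.continuous.tendsto 0).comp hw
    exact h1.eventually_ne (by simp [sincC_zero])
  filter_upwards [nhdsWithin_le_nhds hne, nhdsWithin_le_nhds hc, nhdsWithin_le_nhds hs,
    self_mem_nhdsWithin] with lam h1 h2 h3 h4
  exact (closedForm_eq h4 h1 h2 h3).2.symm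

lemma tendsto_mandelQ
    (h1 : Tendsto (fun L : ℕ => (∫ n, count n ∂(countLaw L)) / L) atTop (𝓝 (2 / 3)))
    (h2 : Tendsto (fun L : ℕ => Var[count; countLaw L] / L) atTop (𝓝 (2 / 45))) :
    Tendsto mandelQ atTop (𝓝 (-14 / 15)) := by
  have h3 := (h2.div h1 (by norm_num)).sub_const 1
  norm_num at h3
  refine (h3.congr' ?_).trans (by norm_num)
  filter_upwards [eventually_gt_atTop 0] with L hL
  have hL' : (L : ℝ) ≠ 0 := by exact_mod_cast hL.ne'
  rw [mandelQ, div_div_div_cancel_right₀ hL']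

end Cumulants

end DimerCovering

open DimerCovering in
theorem mainTheorem3 :
    -- all exponential moments of `N` are finite
    (∀ (L : ℕ) (lam : ℝ), Integrable (fun n => Real.exp (lam * count n)) (countLaw L)) ∧
    -- `y(λ)` is a positive real number, given by the arctangent formula, with `y(λ) → y(0) = 1`
    (∀ lam : ℝ, 0 < y lam) ∧
    (∀ lam : ℝ, lam ≠ 0 →
      (y lam : ℂ) = Complex.arctan (Complex.exp (-lam / 2) * root lam) / Lam lam) ∧
    Tendsto y (𝓝[≠] 0) (𝓝 (y 0)) ∧
    -- closed form of the generating function in the disc `|x| < y(λ)`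
    (∀ lam : ℝ, lam ≠ 0 → ∀ x : ℂ, ‖x‖ < y lam → Complex.cos (Lam lam * x) ≠ 0 →
      Lam lam - Complex.exp lam * Complex.tan (Lam lam * x) ≠ 0 ∧
      HasSum (fun L : ℕ => (F lam L : ℂ) * x ^ (L + 1)) (closedForm lam x)) ∧
    (∀ x : ℂ, ‖x‖ < y 0 →
      HasSum (fun L : ℕ => (F 0 L : ℂ) * x ^ (L + 1)) (x / (1 - x)) ∧
      Tendsto (fun lam : ℝ => closedForm lam x) (𝓝[≠] 0) (𝓝 (x / (1 - x)))) ∧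
    -- `y(λ)` is a simple pole of the generating function
    (∀ lam : ℝ, lam ≠ 0 → meromorphicOrderAt (closedForm lam) (y lam : ℂ) = ((-1 : ℤ) : WithTop ℤ)) ∧
    meromorphicOrderAt (fun x : ℂ => x / (1 - x)) (y 0 : ℂ) = ((-1 : ℤ) : WithTop ℤ) ∧
    -- the cumulant generating function per site
    (∀ lam : ℝ, Tendsto (fun L : ℕ => Real.log (F lam L) / L) atTop (𝓝 (U lam))) ∧
    -- linear growth of all cumulants, with the Taylor coefficients of `U` at `0` as rates
    AnalyticAt ℝ U 0 ∧
    (∀ n : ℕ, 1 ≤ n →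
      Tendsto (fun L : ℕ => cumulant n count (countLaw L) / L) atTop (𝓝 (iteratedDeriv n U 0))) ∧
    Tendsto (fun L : ℕ => (∫ n, count n ∂(countLaw L)) / L) atTop (𝓝 (2 / 3)) ∧
    Tendsto (fun L : ℕ => Var[count; countLaw L] / L) atTop (𝓝 (2 / 45)) ∧
    Tendsto (fun L : ℕ => cumulant 3 count (countLaw L) / L) atTop (𝓝 (2 / 945)) ∧
    Tendsto (fun L : ℕ => cumulant 4 count (countLaw L) / L) atTop (𝓝 (-22 / 4725)) ∧
    -- the Mandel parameter
    Tendsto mandelQ atTop (𝓝 (-14 / 15)) := by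
  have hmean : Tendsto (fun L : ℕ => (∫ n, count n ∂(countLaw L)) / L) atTop (𝓝 (2 / 3)) := by
    simpa only [cumulant_one, iteratedDeriv_U.1] using tendsto_cumulant 1
  have hvar : Tendsto (fun L : ℕ => Var[count; countLaw L] / L) atTop (𝓝 (2 / 45)) := by
    simpa only [cumulant_two, iteratedDeriv_U.2.1] using tendsto_cumulant 2
  refine ⟨integrable_exp_count, y_pos, fun lam h => y_eq h, ?_, ?_, ?_,
    fun lam h => meromorphicOrderAt_closedForm h, meromorphicOrderAt_zero_case,
    tendsto_log_F_div, analyticAt_U, fun n _ => tendsto_cumulant n, hmean, hvar, ?_, ?_,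
    tendsto_mandelQ hmean hvar⟩
  · rw [y_zero]
    exact tendsto_y.mono_left nhdsWithin_le_nhds
  · intro lam hlam x hx hc
    obtain ⟨h1, h2⟩ := closedForm_eq hlam (ne_y_of_norm_lt hx) hc
      (sincC_ne_zero_of_norm_le_y hx.le)
    exact ⟨h1, h2 ▸ hasSum_F lam hx⟩
  · intro x hx
    have h1 := hasSum_F 0 hx
    have hx1 : x ≠ 1 := by simpa [y_zero] using ne_y_of_norm_lt hx
    rw [y_zero] at hx
    refine ⟨?_, tendsto_closedForm hx⟩
    rw [Lam_zero, y_zero] at h1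
    simpa [ricc_one_zero x hx1] using h1
  · simpa only [iteratedDeriv_U.2.2.1] using tendsto_cumulant 3
  · simpa only [iteratedDeriv_U.2.2.2] using tendsto_cumulant 4
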